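/- Let $\mathcal C_1$ and $\mathcal C_2$ be smooth projective irreducible curves over $\mathbb{C}$ and, for $i\in\{1,2\}$, let $\pi_i:\mathcal C_i\to\mathbb{P}^1$ be a finite morphism over $\mathbb{C}$ of degree $d_i\ge 2$. Let $\mathcal B_i\subset\mathbb{P}^1(\mathbb{C})$ be the branch locus of $\pi_i$, and suppose that $|\mathcal B_1\cap\mathcal B_2|\le 1$. Then the fiber product $\mathcal C:=\mathcal C_1\times_{\mathbb{P}^1}\mathcal C_2$, taken relative to $\pi_1$ and $\pi_2$, is irreducible; it is in fact an integral scheme that dominates $\mathbb{P}^1$. Moreover, let $K,K_1,K_2$ be the function fields of $\mathcal C,\mathcal C_1,\mathcal C_2$, regarded as extensions of the function field $\mathbb{C}(t)$ of $\mathbb{P}^1$, and let $L,L_1,L_2$ be their Galois closures over $\mathbb{C}(t)$. Then \[ \operatorname{Gal}(L/\mathbb{C}(t))\;\cong\;\operatorname{Gal}(L_1/\mathbb{C}(t))\times\operatorname{Gal}(L_2/\mathbb{C}(t)). \] -/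

import Mathlib

open CategoryTheory CategoryTheory.Limits AlgebraicGeometry

attribute [local instance] MvPolynomial.gradedAlgebra

namespace CurveCover

noncomputable section

/-- Projective `n`-space over the complex numbers, `Proj ℂ[x₀, …, xₙ]`. -/
def ProjSpace (n : ℕ) : Scheme.{0} :=
  Proj (MvPolynomial.homogeneousSubmodule (Fin (n + 1)) ℂ)

/-- The structure morphism of projective space over `ℂ`. -/
def ProjSpace.toSpec (n : ℕ) : ProjSpace n ⟶ Spec (CommRingCat.of ℂ) :=
  Proj.toSpecZero (MvPolynomial.homogeneousSubmodule (Fin (n + 1)) ℂ) ≫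
    Spec.map (CommRingCat.ofHom
      (algebraMap ℂ (MvPolynomial.homogeneousSubmodule (Fin (n + 1)) ℂ 0)))

instance ProjSpace.irreducibleSpace (n : ℕ) : IrreducibleSpace (ProjSpace n) := by
  let z : ProjectiveSpectrum (MvPolynomial.homogeneousSubmodule (Fin (n + 1)) ℂ) :=
    { asHomogeneousIdeal := ⊥
      isPrime := by
        rw [HomogeneousIdeal.toIdeal_bot]
        exact Ideal.isPrime_bot
      not_irrelevant_le := by
        intro h
        have hX : (MvPolynomial.X 0 : MvPolynomial (Fin (n + 1)) ℂ) ∈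
            HomogeneousIdeal.irrelevant
              (MvPolynomial.homogeneousSubmodule (Fin (n + 1)) ℂ) := by
          rw [HomogeneousIdeal.mem_irrelevant_iff, GradedRing.proj_apply,
            DirectSum.decompose_of_mem_ne _
              ((MvPolynomial.mem_homogeneousSubmodule _ _).2
                (MvPolynomial.isHomogeneous_X ℂ (0 : Fin (n + 1)))) one_ne_zero]
        have h0 := h hX
        rw [← HomogeneousIdeal.mem_iff, HomogeneousIdeal.toIdeal_bot, Ideal.mem_bot] at h0
        exact MvPolynomial.X_ne_zero _ h0 }
  have hz : closure ({z} : Set _) = Set.univ := by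
    refine Set.eq_univ_of_forall fun y => ?_
    rw [← ProjectiveSpectrum.le_iff_mem_closure, ← ProjectiveSpectrum.as_ideal_le_as_ideal]
    exact bot_le
  have : IrreducibleSpace
      (ProjectiveSpectrum (MvPolynomial.homogeneousSubmodule (Fin (n + 1)) ℂ)) :=
    { isPreirreducible_univ := by
        rw [← hz]
        exact isIrreducible_singleton.closure.2
      toNonempty := ⟨z⟩ }
  exact this

instance ProjSpace.isIntegral (n : ℕ) : IsIntegral (ProjSpace n) := by
  have : ∀ x : ProjSpace n, _root_.IsReduced ((ProjSpace n).presheaf.stalk x) := fun x => by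
    let P := x.asHomogeneousIdeal.toIdeal
    have hP : P.IsPrime := x.isPrime
    have : IsDomain (Localization.AtPrime P) :=
      IsLocalization.isDomain_localization P.primeCompl_le_nonZeroDivisors
    have : _root_.IsReduced (HomogeneousLocalization.AtPrime
        (MvPolynomial.homogeneousSubmodule (Fin (n + 1)) ℂ) P) :=
      isReduced_of_injective (algebraMap _ (Localization.AtPrime P))
        (HomogeneousLocalization.val_injective _)
    exact isReduced_of_injective
      (Proj.stalkIso (MvPolynomial.homogeneousSubmodule (Fin (n + 1)) ℂ) x).hom.hom
      (ConcreteCategory.bijective_of_isIso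
        (Proj.stalkIso (MvPolynomial.homogeneousSubmodule (Fin (n + 1)) ℂ) x).hom).injective
  have : AlgebraicGeometry.IsReduced (ProjSpace n) := isReduced_of_isReduced_stalk _
  exact isIntegral_of_irreducibleSpace_of_isReduced _

/-- A `ℂ`-scheme is projective if it admits a closed immersion over `ℂ` into some `ℙⁿ`. -/
def IsProjective {C : Scheme.{0}} (s : C ⟶ Spec (CommRingCat.of ℂ)) : Prop :=
  ∃ (n : ℕ) (i : C ⟶ ProjSpace n), IsClosedImmersion i ∧ i ≫ ProjSpace.toSpec n = s

lemma map_genericPoint {X Y : Scheme.{0}} [IrreducibleSpace X] [IrreducibleSpace Y]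
    (f : X ⟶ Y) [IsDominant f] : f (genericPoint X) = genericPoint Y := by
  refine ((genericPoint_spec Y).eq ?_).symm
  have h := (genericPoint_spec X).image f.continuous
  rwa [Set.image_univ, f.denseRange.closure_range] at h

/-- The field extension `K(Y) → K(X)` induced by a dominant morphism of integral schemes. -/
def functionFieldMap {X Y : Scheme.{0}} [IsIntegral X] [IsIntegral Y]
    (f : X ⟶ Y) [IsDominant f] : Y.functionField →+* X.functionField :=
  (Y.presheaf.stalkSpecializes (specializes_of_eq (map_genericPoint f)) ≫
    f.stalkMap (genericPoint X)).hom

/-- The degree `[K : F]` of a field extension `φ : F → K`. -/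
def extensionDegree {F K : Type} [Field F] [Field K] (φ : F →+* K) : ℕ :=
  letI := φ.toAlgebra
  Module.finrank F K

open Classical in
/-- The degree `[K(X) : K(Y)]` of a dominant morphism of integral schemes
(and `0` if the morphism is not dominant). -/
def degree {X Y : Scheme.{0}} [IsIntegral X] [IsIntegral Y] (f : X ⟶ Y) : ℕ :=
  if _h : IsDominant f then extensionDegree (functionFieldMap f) else 0

/-- `f` is ramified at `x` if the maximal ideal at `f x` does not generate the maximal ideal
at `x`; for curves over `ℂ` this says that the ramification index at `x` exceeds `1`. -/
def IsRamifiedAt {X Y : Scheme.{0}} (f : X ⟶ Y) (x : X) : Prop :=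
  (IsLocalRing.maximalIdeal (Y.presheaf.stalk (f x))).map (f.stalkMap x).hom ≠
    IsLocalRing.maximalIdeal (X.presheaf.stalk x)

/-- The branch locus: the closed points of `Y` (its `ℂ`-points, for `Y` of finite type over
`ℂ`) over which there is a point at which `f` is ramified. -/
def branchLocus {X Y : Scheme.{0}} (f : X ⟶ Y) : Set Y :=
  {y | IsClosed ({y} : Set Y) ∧ ∃ x : X, f x = y ∧ IsRamifiedAt f x}

/-- `Gal(L/F)` where `L` is the normal closure over `F` of the extension `φ : F → K`,
formed in an algebraic closure of `K`. -/
abbrev NormalClosureGroup {F K : Type} [Field F] [Field K] (φ : F →+* K) : Type :=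
  letI := φ.toAlgebra
  Gal(IntermediateField.normalClosure F K (AlgebraicClosure K)/F)

/-- The Galois group of the Galois closure of the function field extension `K(X)/K(Y)`. -/
abbrev GaloisClosureGroup {X Y : Scheme.{0}} [IsIntegral X] [IsIntegral Y]
    (f : X ⟶ Y) [IsDominant f] : Type :=
  NormalClosureGroup (functionFieldMap f)

end

end CurveCover

/-! Inside an algebraic closure of `ℂ(t)` let `N₁`, `N₂` be the normal closures of `K₁`, `K₂`, and
put `M = N₁ ∩ N₂`. At a point that is not a branch point of `πᵢ`, the field `Kᵢ` splits completely
over the Laurent series at that point (Hensel), and hence so do `Nᵢ` and its subfield `M`. At most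
one point is a branch point of both covers, so `M` splits at every point but at most one. Once that
point is placed at infinity, `M` splits over the whole affine line, which is simply connected;
therefore `M = ℂ(t)`.

Simple connectedness (`algebraMap_surjective_of_splitAlong`) is proved with derivations. Since `M`
splits over the affine line, the extension `D` of `d/dX` to `M` acts termwise on power series
expansions and so preserves the integral closure `O` of `k[X]`. At infinity, with `s = 1/X`, the
logarithmic derivation `θ = s d/ds = -X D` preserves the functions without poles, whatever the
ramification, because the characteristic is zero. Hence each application of `D` lowers the pole
order at infinity, measured in powers of `s`. For `f` in `O` some `Dⁿ f` is regular everywhere, thus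
constant, and integrating back shows that `f` is a polynomial. So `O = k[X]` and `M = k(X)`.

From `N₁ ∩ N₂ = ℂ(t)` both conclusions follow. The fields `N₁`, `N₂` are Galois, hence linearly
disjoint, and `K₁ ⊗ K₂` is a domain. Over each standard chart of the line the coordinate rings of
the curves are finite free over a polynomial ring, so their tensor product embeds in `K₁ ⊗ K₂`; the
resulting integral charts of the fiber product share a point over the generic point and glue to an
integral scheme. Its function field is a compositum of `K₁` and `K₂`, with normal closure `N₁N₂`,
whose Galois group is the product. -/

namespace CurveCover

open Polynomial

/-! ### Hensel's lemma and complete splitting over Laurent series -/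

section Splitting

/-- The field of formal Laurent series, as the fraction field of the ring of power series. -/
abbrev LaurentField (k : Type*) [Field k] : Type _ := FractionRing (PowerSeries k)

/-- The extension `M / F` splits completely along the embedding `j : F → E`: every extension of
`j` to `M` with values in an algebraic closure of `E` takes its values in `E`. -/
def SplitAlong {F E : Type*} [Field F] [Field E] (j : F →+* E) (M : Type*) [Field M]
    [Algebra F M] : Prop :=
  ∀ φ : M →+* AlgebraicClosure E,
    φ.comp (algebraMap F M) = (algebraMap E (AlgebraicClosure E)).comp j →
      ∀ m, φ m ∈ (algebraMap E (AlgebraicClosure E)).range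

/-- The extension `M / F` is generated by a root of a monic polynomial over `k[X]` whose
specialisation at `X = a` is separable. -/
def HasSeparableModel {k F : Type*} [Field k] [Field F] (ι : k[X] →+* F) (a : k) (M : Type*)
    [Field M] [Algebra F M] : Prop :=
  ∃ (f : M) (p : k[X][X]), p.Monic ∧ p.eval₂ ((algebraMap F M).comp ι) f = 0 ∧
    (p.map (evalRingHom a)).Separable ∧ IntermediateField.adjoin F {f} = ⊤

/-- Each root of the reduction is simple, so it lifts by Hensel's lemma. The reduction has `deg q`
distinct roots, hence `q` has at least that many. -/
lemma splits_of_separable_map_constantCoeff {k : Type*} [Field k] [IsAlgClosed k]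
    {q : (PowerSeries k)[X]} (hq : q.Monic)
    (hs : (q.map (PowerSeries.constantCoeff (R := k))).Separable) : q.Splits := by
  classical
  set q' := q.map (PowerSeries.constantCoeff (R := k)) with hq'
  have hq'0 : q' ≠ 0 := (hq.map _).ne_zero
  have key : ∀ z ∈ q'.roots, ∃ r : PowerSeries k, r ∈ q.roots ∧ PowerSeries.constantCoeff r = z := by
    intro z hz
    have hz0 : q'.eval z = 0 := ((mem_roots hq'0).1 hz)
    have hz1 : q'.derivative.eval z ≠ 0 := by
      have := hs.eval₂_derivative_ne_zero (RingHom.id k) (x := z) (by simpa using hz0)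
      simpa using this
    have hev : ∀ p : (PowerSeries k)[X], PowerSeries.constantCoeff (p.eval (PowerSeries.C z)) =
        (p.map (PowerSeries.constantCoeff (R := k))).eval z := by
      intro p
      rw [Polynomial.eval_map, ← eval₂_at_apply]
      simp
    obtain ⟨r, hr, hrz⟩ := HenselianRing.is_henselian
      (I := Ideal.span {(PowerSeries.X : PowerSeries k)}) q hq (PowerSeries.C z)
      (by
        rw [Ideal.mem_span_singleton, PowerSeries.X_dvd_iff, hev]; exact hz0)
      (by
        refine IsUnit.map _ ?_
        rw [PowerSeries.isUnit_iff_constantCoeff, hev, ← derivative_map]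
        exact isUnit_iff_ne_zero.2 hz1)
    refine ⟨r, (mem_roots hq.ne_zero).2 hr, ?_⟩
    rw [Ideal.mem_span_singleton, PowerSeries.X_dvd_iff, map_sub, sub_eq_zero] at hrz
    simpa using hrz
  rw [splits_iff_card_roots]
  refine le_antisymm (card_roots' q) ?_
  have h1 : q'.roots.toFinset ⊆ q.roots.toFinset.image (PowerSeries.constantCoeff (R := k)) := by
    intro z hz
    obtain ⟨r, hr, hz⟩ := key z (Multiset.mem_toFinset.1 hz)
    exact Finset.mem_image.2 ⟨r, Multiset.mem_toFinset.2 hr, hz⟩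
  calc q.natDegree = q'.natDegree := (hq.natDegree_map _).symm
    _ = Multiset.card q'.roots := (splits_iff_card_roots.1 (IsAlgClosed.splits q')).symm
    _ = q'.roots.toFinset.card := (Multiset.toFinset_card_of_nodup (nodup_roots hs)).symm
    _ ≤ _ := Finset.card_le_card h1
    _ ≤ q.roots.toFinset.card := Finset.card_image_le
    _ ≤ _ := Multiset.toFinset_card_le _

/-- The model polynomial, with `X` replaced by `g`, splits over `k[[X]]`, so the generator `f` goes
to a Laurent series, and with it all of `M`. Allowing any `g` with constant term `a`, not just `a +
X`, is what permits a later change of coordinate on the line. -/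
lemma HasSeparableModel.splitAlong {k F M : Type*} [Field k] [IsAlgClosed k] [Field F] [Field M]
    [Algebra F M] {ι : k[X] →+* F} {a : k} (h : HasSeparableModel ι a M)
    (j : F →+* LaurentField k) (g : PowerSeries k) (hg : PowerSeries.constantCoeff g = a)
    (hj : ∀ p, j (ι p) = algebraMap (PowerSeries k) (LaurentField k) (aeval g p)) :
    SplitAlong j M := by
  obtain ⟨f, p, hp, hpf, hsep, hf⟩ := h
  intro φ hφ
  set r : k[X] →+* PowerSeries k := (aeval g : k[X] →ₐ[k] PowerSeries k).toRingHom with hr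
  have hcomp : (PowerSeries.constantCoeff (R := k)).comp r = evalRingHom a := by
    refine Polynomial.ringHom_ext (fun c => ?_) ?_
    · simp [hr]
    · simp [hr, hg]
  have hsplit : (p.map r).Splits := by
    refine splits_of_separable_map_constantCoeff (hp.map _) ?_
    rwa [Polynomial.map_map, hcomp]
  have hsplit' := hsplit.map (algebraMap (PowerSeries k) (LaurentField k))
  have hφf : φ f ∈ (algebraMap (LaurentField k) (AlgebraicClosure (LaurentField k))).range := by
    refine hsplit'.mem_range_of_isRoot ((hp.map _).map _).ne_zero ?_
    have h0 := congrArg φ hpf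
    rw [hom_eval₂, map_zero] at h0
    rw [IsRoot.def, Polynomial.eval_map, eval₂_map, eval₂_map]
    rw [← h0]
    refine congrArg (fun u => eval₂ u (φ f) p) (RingHom.ext fun x => ?_)
    have := congrArg (fun u => u (ι x)) hφ
    simp only [RingHom.comp_apply] at this ⊢
    rw [this, hj]
    rfl
  let S : IntermediateField F M :=
    { ((algebraMap (LaurentField k) (AlgebraicClosure (LaurentField k))).fieldRange.comap φ) with
      algebraMap_mem' := fun x => by
        have := congrArg (fun u => u x) hφ
        simp only [RingHom.comp_apply] at this
        exact ⟨j x, this.symm⟩ }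
  have hS : IntermediateField.adjoin F {f} ≤ S :=
    IntermediateField.adjoin_simple_le_iff.2 hφf
  rw [hf] at hS
  exact fun m => hS (IntermediateField.mem_top (x := m))

/-- The normal closure is generated by the images of the `F`-embeddings of `K`; composing `φ` with
any of these gives an extension of `j` to `K`, where the hypothesis applies. -/
lemma SplitAlong.normalClosure {F E K : Type*} [Field F] [Field E] [Field K] [Algebra F K]
    {j : F →+* E} (h : SplitAlong j K) (L : Type*) [Field L] [Algebra F L] :
    SplitAlong j (IntermediateField.normalClosure F K L) := by
  intro φ hφ
  let S : IntermediateField F (IntermediateField.normalClosure F K L) :=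
    { ((algebraMap E (AlgebraicClosure E)).fieldRange.comap φ) with
      algebraMap_mem' := fun x => by
        have := congrArg (fun u => u x) hφ
        simp only [RingHom.comp_apply] at this
        exact ⟨j x, this.symm⟩ }
  have hS : IntermediateField.normalClosure F K L ≤ IntermediateField.lift S := by
    rw [_root_.normalClosure_le_iff]
    rintro f _ ⟨x, rfl⟩
    have hx : f x ∈ IntermediateField.normalClosure F K L := f.fieldRange_le_normalClosure ⟨x, rfl⟩
    refine (IntermediateField.mem_lift (E := S) ⟨f x, hx⟩).2 ?_
    let f' : K →ₐ[F] IntermediateField.normalClosure F K L :=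
      f.codRestrict (IntermediateField.normalClosure F K L).toSubalgebra
        (fun y => f.fieldRange_le_normalClosure ⟨y, rfl⟩)
    exact h (φ.comp f'.toRingHom) (by
      rw [← hφ, RingHom.comp_assoc]
      congr 1
      ext y
      simp [f']) x
  intro m
  have hm := hS m.2
  exact (IntermediateField.mem_lift (E := S) m).1 hm

/-- An embedding of `N` in an algebraically closed field extends to the algebraic extension `M` of
`N`. -/
lemma SplitAlong.of_algHom {F E M N : Type*} [Field F] [Field E] [Field M] [Field N] [Algebra F M]
    [Algebra F N] {j : F →+* E} (h : SplitAlong j M) [Algebra.IsAlgebraic F M] (i : N →ₐ[F] M) :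
    SplitAlong j N := by
  intro φ hφ n
  let : Algebra N M := i.toRingHom.toAlgebra
  have : IsScalarTower F N M := IsScalarTower.of_algebraMap_eq fun x => (i.commutes x).symm
  let : Algebra N (AlgebraicClosure E) := φ.toAlgebra
  have : Algebra.IsAlgebraic N M := Algebra.IsAlgebraic.tower_top (K := F) N
  let ψ : M →ₐ[N] AlgebraicClosure E := IsAlgClosed.lift
  have := h ψ.toRingHom (by
    rw [← hφ]
    ext x
    have : algebraMap F M x = algebraMap N M (algebraMap F N x) :=
      IsScalarTower.algebraMap_apply F N M x
    simp only [RingHom.comp_apply, this]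
    exact ψ.commutes _) (algebraMap N M n)
  rwa [show ψ.toRingHom (algebraMap N M n) = φ n from ψ.commutes n] at this

end Splitting

end CurveCover
namespace CurveCover

open Polynomial

/-! ### Extension and uniqueness of derivations -/

section Derivations

/-- An additive endomorphism satisfying the Leibniz rule. -/
def IsLeibniz {A : Type*} [CommRing A] (D : A →+ A) : Prop :=
  ∀ x y, D (x * y) = x * D y + y * D x

/-- For formally étale `B` over `A` one has `Ω_B = B ⊗ Ω_A`, so the linear form on `Ω_A` given by
`d` extends to `Ω_B`. -/
lemma exists_isLeibniz_of_formallyEtale (A B : Type*) [CommRing A] [CommRing B] [Algebra A B]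
    [Algebra.FormallyEtale A B] (d : A →+ A) (hd : IsLeibniz d) :
    ∃ D : B →+ B, IsLeibniz D ∧ ∀ a, D (algebraMap A B a) = algebraMap A B (d a) := by
  let d' : Derivation ℤ A A := Derivation.mk' d.toIntLinearMap hd
  let e := KaehlerDifferential.tensorKaehlerEquivOfFormallyEtale ℤ A B
  let l : TensorProduct A B (KaehlerDifferential ℤ A) →ₗ[B] B :=
    TensorProduct.AlgebraTensorModule.lift
      (LinearMap.toSpanSingleton B _ ((Algebra.linearMap A B).comp d'.liftKaehlerDifferential))
  let D : Derivation ℤ B B := (l.comp e.symm.toLinearMap).compDer (KaehlerDifferential.D ℤ B)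
  refine ⟨D.toLinearMap.toAddMonoidHom, D.leibniz, fun a => ?_⟩
  have := KaehlerDifferential.tensorKaehlerEquivOfFormallyEtale_symm_D_algebraMap ℤ A B a
  simp [D, e, l, this, d']
  rfl

/-- The difference `φ ∘ D - δ ∘ φ` is an `A`-derivation from `B` to `E`, and it vanishes because
`Ω_{B/A} = 0`. -/
lemma IsLeibniz.map_eq_of_formallyUnramified {A B E : Type*} [CommRing A] [CommRing B] [CommRing E]
    [Algebra A B] [Algebra.FormallyUnramified A B] (φ : B →+* E) {D : B →+ B} (hD : IsLeibniz D)
    {δ : E →+ E} (hδ : IsLeibniz δ)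
    (h : ∀ a, φ (D (algebraMap A B a)) = δ (φ (algebraMap A B a))) (b : B) :
    φ (D b) = δ (φ b) := by
  let := φ.toAlgebra
  let := (φ.comp (algebraMap A B)).toAlgebra
  have : IsScalarTower A B E := IsScalarTower.of_algebraMap_eq fun _ => rfl
  have hmul : ∀ x y, φ (D (x * y)) - δ (φ (x * y)) =
      φ x * (φ (D y) - δ (φ y)) + φ y * (φ (D x) - δ (φ x)) := fun x y => by
    rw [hD, map_mul φ x, hδ, map_add, map_mul, map_mul]; ring
  let T : B →ₗ[A] E :=
    { toFun := fun b => φ (D b) - δ (φ b)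
      map_add' := fun x y => by simp only [map_add]; ring
      map_smul' := fun a x => by
        rw [Algebra.smul_def, hmul, h, sub_self, mul_zero, add_zero, Algebra.smul_def]
        rfl }
  let Δ : Derivation A B E := Derivation.mk' T (fun x y => by
    rw [Algebra.smul_def, Algebra.smul_def]
    exact hmul x y)
  have h0 : Δ = 0 := by
    rw [← Δ.liftKaehlerDifferential_comp, Subsingleton.elim Δ.liftKaehlerDifferential 0]
    ext x
    simp
  have := congrArg (fun u => u b) h0
  exact sub_eq_zero.1 this

end Derivations

/-! ### Expansions of rational functions on the affine line -/

section Regularity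

variable {k : Type*} [Field k] {F : Type*} [Field F] [Algebra k[X] F] [IsFractionRing k[X] F]

/-- The expansion of a rational function as a Laurent series in the local parameter `X - c`. -/
def IsExpansionAt (c : k) (j : F →+* LaurentField k) : Prop :=
  ∀ p : k[X], j (algebraMap k[X] F p) = algebraMap (PowerSeries k) (LaurentField k)
    (aeval (PowerSeries.C c + PowerSeries.X) p)

lemma constantCoeff_aeval (g : PowerSeries k) (p : k[X]) :
    PowerSeries.constantCoeff (aeval g p) = p.eval (PowerSeries.constantCoeff g) := by
  have : (PowerSeries.constantCoeff (R := k)).comp (aeval g : k[X] →ₐ[k] PowerSeries k).toRingHom =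
      evalRingHom (PowerSeries.constantCoeff g) :=
    Polynomial.ringHom_ext (fun c => by simp) (by simp)
  exact congrArg (fun u => u p) this

lemma aeval_C_add_X (c : k) (p : k[X]) :
    aeval (PowerSeries.C c + PowerSeries.X) p = ((taylor c p : k[X]) : PowerSeries k) := by
  have : (aeval (PowerSeries.C c + PowerSeries.X) : k[X] →ₐ[k] PowerSeries k).toRingHom =
      (Polynomial.coeToPowerSeries.ringHom (R := k)).comp (taylorAlgHom c).toRingHom := by
    refine Polynomial.ringHom_ext (fun a => ?_) ?_
    · simp
    · simp [add_comm]
  exact congrArg (fun u => u p) this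

variable (F) in
lemma exists_isExpansionAt (c : k) : ∃ j : F →+* LaurentField k, IsExpansionAt c j := by
  have hinj : Function.Injective ((algebraMap (PowerSeries k) (LaurentField k)).comp
      (aeval (PowerSeries.C c + PowerSeries.X) : k[X] →ₐ[k] PowerSeries k).toRingHom) := by
    refine (IsFractionRing.injective (PowerSeries k) (LaurentField k)).comp fun p q h => ?_
    have h' : ((taylor c p : k[X]) : PowerSeries k) = (taylor c q : k[X]) := by
      rw [← aeval_C_add_X, ← aeval_C_add_X]; exact h
    exact taylor_injective c (Polynomial.coe_injective _ h')
  exact ⟨IsFractionRing.lift hinj, fun p => IsFractionRing.lift_algebraMap hinj p⟩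

/-- A nonconstant denominator in lowest terms has a root `c`; regularity at `c` makes `c` a root of
the numerator too, contradicting coprimality. -/
lemma mem_range_of_forall_isExpansionAt [IsAlgClosed k] (y : F)
    (h : ∀ c : k, ∀ j : F →+* LaurentField k, IsExpansionAt c j →
      j y ∈ (algebraMap (PowerSeries k) (LaurentField k)).range) :
    y ∈ (algebraMap k[X] F).range := by
  obtain ⟨P, Q, hPQ, rfl⟩ := IsFractionRing.exists_reduced_fraction (A := k[X]) y
  have hQ0 : algebraMap k[X] F Q ≠ 0 := IsFractionRing.to_map_ne_zero_of_mem_nonZeroDivisors Q.2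
  rw [IsFractionRing.mk'_eq_div] at h ⊢
  by_cases hQ : IsUnit (Q : k[X])
  · obtain ⟨u, hu⟩ := hQ
    refine ⟨P * (u⁻¹ : k[X]ˣ), ?_⟩
    rw [eq_div_iff hQ0, ← hu, ← map_mul, mul_assoc, Units.inv_mul, mul_one]
  · exfalso
    obtain ⟨c, hc⟩ := IsAlgClosed.exists_root (Q : k[X]) (fun h0 => hQ
      (Polynomial.isUnit_iff_degree_eq_zero.2 h0))
    obtain ⟨j, hj⟩ := exists_isExpansionAt F c
    obtain ⟨g, hg⟩ := h c j hj
    have h1 : algebraMap (PowerSeries k) (LaurentField k)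
        (g * aeval (PowerSeries.C c + PowerSeries.X) (Q : k[X])) =
        algebraMap (PowerSeries k) (LaurentField k)
          (aeval (PowerSeries.C c + PowerSeries.X) P) := by
      rw [map_mul, hg, ← hj, ← hj, ← map_mul, div_mul_cancel₀ _ hQ0]
    have h2 := congrArg (PowerSeries.constantCoeff (R := k))
      (IsFractionRing.injective (PowerSeries k) (LaurentField k) h1)
    simp only [map_mul, constantCoeff_aeval, map_add, PowerSeries.constantCoeff_C,
      PowerSeries.constantCoeff_X, add_zero, hc.eq_zero, mul_zero] at h2
    have h3 := hPQ (dvd_iff_isRoot.2 h2.symm) (dvd_iff_isRoot.2 hc)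
    exact not_isUnit_X_sub_C c h3

end Regularity

/-! ### The derivation `d/dX` on integral elements -/

section IntegralDerivation

variable {k : Type*} [Field k] [IsAlgClosed k] [CharZero k]
  {F : Type*} [Field F] [Algebra k[X] F] [IsFractionRing k[X] F]
  {M : Type*} [Field M] [Algebra F M] [FiniteDimensional F M]

lemma exists_isLeibniz_laurentField (k : Type*) [Field k] : ∃ δ : LaurentField k →+ LaurentField k, IsLeibniz δ ∧
    ∀ g : PowerSeries k, δ (algebraMap _ _ g) = algebraMap _ _ (PowerSeries.derivative k g) := by
  have : Algebra.FormallyEtale (PowerSeries k) (LaurentField k) :=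
    Algebra.FormallyEtale.of_isLocalization (nonZeroDivisors (PowerSeries k))
  exact exists_isLeibniz_of_formallyEtale _ _
    (PowerSeries.derivative k).toLinearMap.toAddMonoidHom (PowerSeries.derivative k).leibniz

lemma derivative_aeval_C_add_X {k : Type*} [Field k] (c : k) (p : k[X]) :
    PowerSeries.derivative k (aeval (PowerSeries.C c + PowerSeries.X) p) =
      aeval (PowerSeries.C c + PowerSeries.X) (derivative p) := by
  rw [aeval_C_add_X, aeval_C_add_X, PowerSeries.derivative_coe]
  congr 1
  simp [taylor_apply, derivative_comp]

omit [IsAlgClosed k] in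
/-- Elements of `M` integral over `k[X]` have power series expansions, and derivations are
computed termwise. -/
lemma exists_expansion {c : k} {j : F →+* LaurentField k} (hj : IsExpansionAt c j)
    (hs : SplitAlong j M) {D : M →+ M} (hD : IsLeibniz D)
    (hDX : ∀ p : k[X], D (algebraMap F M (algebraMap k[X] F p)) =
      algebraMap F M (algebraMap k[X] F (derivative p)))
    {f : M} (hf : ((algebraMap F M).comp (algebraMap k[X] F)).IsIntegralElem f)
    (φ : M →+* AlgebraicClosure (LaurentField k))
    (hφ : φ.comp (algebraMap F M) = (algebraMap (LaurentField k) _).comp j) :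
    ∃ g : PowerSeries k,
      algebraMap (LaurentField k) _ (algebraMap (PowerSeries k) (LaurentField k) g) = φ f ∧
      algebraMap (LaurentField k) _ (algebraMap (PowerSeries k) (LaurentField k)
        (PowerSeries.derivative k g)) = φ (D f) := by
  let := ((algebraMap F M).comp (algebraMap k[X] F)).toAlgebra
  have : IsScalarTower k[X] F M := IsScalarTower.of_algebraMap_eq fun _ => rfl
  have : CharZero F := charZero_of_injective_algebraMap
    (IsFractionRing.injective k[X] F)
  have : Algebra.FormallyEtale F M := Algebra.FormallyEtale.of_isSeparable F M
  have : Algebra.FormallyEtale k[X] F :=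
    Algebra.FormallyEtale.of_isLocalization (nonZeroDivisors k[X])
  have : Algebra.FormallyEtale k[X] M := Algebra.FormallyEtale.comp k[X] F M
  obtain ⟨δ, hδ, hδX⟩ := exists_isLeibniz_laurentField k
  choose ψ0 hψ0 using hs φ hφ
  let i := algebraMap (LaurentField k) (AlgebraicClosure (LaurentField k))
  -- Splitting lets `φ` factor through the Laurent series field itself.
  let ψ : M →+* LaurentField k :=
    { toFun := ψ0
      map_one' := i.injective (by rw [hψ0, map_one, map_one])
      map_mul' := fun x y => i.injective (by rw [hψ0, map_mul, map_mul, hψ0, hψ0])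
      map_zero' := i.injective (by rw [hψ0, map_zero, map_zero])
      map_add' := fun x y => i.injective (by rw [hψ0, map_add, map_add, hψ0, hψ0]) }
  have hψF : ∀ x, ψ (algebraMap F M x) = j x := fun x =>
    i.injective ((hψ0 _).trans (congrArg (fun u => u x) hφ))
  have hψf : IsIntegral (PowerSeries k) (ψ f) := by
    obtain ⟨p, hp, hpf⟩ := hf
    refine ⟨p.map (aeval (PowerSeries.C c + PowerSeries.X) :
      k[X] →ₐ[k] PowerSeries k).toRingHom, hp.map _, ?_⟩
    have h0 := congrArg ψ hpf
    rw [hom_eval₂, map_zero] at h0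
    rw [eval₂_map, ← h0]
    refine congrArg (fun u => eval₂ u (ψ f) p) (RingHom.ext fun x => ?_)
    exact (hj x).symm.trans (hψF _).symm
  obtain ⟨g, hg⟩ := IsIntegrallyClosed.isIntegral_iff.1 hψf
  -- Both `ψ ∘ D` and `δ ∘ ψ` extend `d/dX`, and `M` is unramified over `k[X]`.
  have hder : ψ (D f) = δ (ψ f) := by
    refine hD.map_eq_of_formallyUnramified (A := k[X]) ψ hδ (fun a => ?_) f
    rw [show algebraMap k[X] M a = algebraMap F M (algebraMap k[X] F a) from rfl, hDX, hψF,
      hψF, hj, hj, hδX, derivative_aeval_C_add_X]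
  refine ⟨g, ?_, ?_⟩
  · rw [hg]
    exact hψ0 f
  · rw [← hδX, hg, ← hder]
    exact hψ0 _

/-- If `M` splits over every point of the affine line then the derivation `d/dX` preserves the
integral closure of `k[X]` in `M`. -/
lemma isIntegralElem_derivation
    (hsplit : ∀ c : k, ∀ j : F →+* LaurentField k, IsExpansionAt c j → SplitAlong j M)
    {D : M →+ M} (hD : IsLeibniz D) (hDX : ∀ p : k[X], D (algebraMap F M (algebraMap k[X] F p)) =
      algebraMap F M (algebraMap k[X] F (derivative p)))
    {f : M} (hf : ((algebraMap F M).comp (algebraMap k[X] F)).IsIntegralElem f) :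
    ((algebraMap F M).comp (algebraMap k[X] F)).IsIntegralElem (D f) := by
  have hint : IsIntegral F (D f) := Algebra.IsIntegral.isIntegral _
  -- The conjugates of `D f` over the point `c` are the elements `φ (D f)`, all of them power
  -- series. Hence the coefficients of the minimal polynomial have no pole at any `c`, that is, they
  -- are polynomials.
  have hcoef : minpoly F (D f) ∈ lifts (algebraMap k[X] F) := by
    rw [lifts_iff_coeff_lifts]
    intro n
    refine mem_range_of_forall_isExpansionAt _ fun c j hj => ?_
    set Ω := AlgebraicClosure (LaurentField k)
    let iΩ : PowerSeries k →+* Ω :=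
      (algebraMap (LaurentField k) Ω).comp (algebraMap (PowerSeries k) (LaurentField k))
    let : Algebra F Ω := ((algebraMap (LaurentField k) Ω).comp j).toAlgebra
    have hroots : ∀ r ∈ ((minpoly F (D f)).map (algebraMap F Ω)).roots, r ∈ iΩ.range := by
      intro r hr
      have hr' : r ∈ (minpoly F (D f)).rootSet Ω := by
        rw [mem_rootSet]
        refine ⟨minpoly.ne_zero hint, ?_⟩
        have := isRoot_of_mem_roots hr
        rwa [IsRoot.def, eval_map_algebraMap] at this
      rw [← Algebra.IsAlgebraic.range_eval_eq_rootSet_minpoly] at hr'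
      obtain ⟨φ, rfl⟩ := hr'
      obtain ⟨g, -, hg⟩ := exists_expansion hj (hsplit c j hj) hD hDX hf φ.toRingHom
        (RingHom.ext fun x => φ.commutes x)
      exact ⟨PowerSeries.derivative k g, hg⟩
    have hl := (IsAlgClosed.splits
      ((minpoly F (D f)).map (algebraMap F Ω))).mem_lift_of_roots_mem_range
      ((minpoly.monic hint).map _) iΩ hroots
    obtain ⟨g, hg⟩ := (lifts_iff_coeff_lifts _).1 hl n
    refine ⟨g, (algebraMap (LaurentField k) Ω).injective (hg.trans ?_)⟩
    rw [coeff_map]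
    rfl
  obtain ⟨q, hq, -, hqm⟩ := lifts_and_natDegree_eq_and_monic hcoef (minpoly.monic hint)
  refine ⟨q, hqm, ?_⟩
  rw [← eval₂_map, hq]
  exact minpoly.aeval F (D f)

end IntegralDerivation

end CurveCover
namespace CurveCover

open Polynomial

/-! ### Logarithmic derivations at a ramified place -/

section TameDerivation

lemma IsLeibniz.map_one {A : Type*} [CommRing A] {D : A →+ A} (hD : IsLeibniz D) : D 1 = 0 := by
  have := hD 1 1
  simpa using this

lemma IsLeibniz.map_pow_succ {A : Type*} [CommRing A] {D : A →+ A} (hD : IsLeibniz D) (x : A)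
    (n : ℕ) : D (x ^ (n + 1)) = (n + 1) * x ^ n * D x := by
  induction n with
  | zero => simp
  | succ n ih => rw [pow_succ, hD, ih]; push_cast; ring

open WithZero in
/-- A derivation that is bounded on a discrete valuation ring with residue field `k` of
characteristic zero, and that does not decrease the valuation of one element of the maximal
ideal, preserves the valuation ring. -/
lemma IsLeibniz.valuation_le_one {k M : Type*} [Field k] [CharZero k] [Field M] {θ : M →+ M}
    (hθ : IsLeibniz θ) (w : Valuation M ℤᵐ⁰) (κ : k →+* M) (hκ : ∀ c, w (κ c) ≤ 1)
    (hθκ : ∀ c, θ (κ c) = 0) {u s : M} (hu : w u = exp (-1 : ℤ)) (hs0 : s ≠ 0) (hs : w s < 1)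
    (hθs : w (θ s) ≤ w s) (hres : ∀ f, w f ≤ 1 → ∃ c, w (f - κ c) < 1)
    (N : ℕ) (hN : ∀ f, w f ≤ 1 → w (θ f) ≤ exp (N : ℤ)) (f : M) (hf : w f ≤ 1) :
    w (θ f) ≤ 1 := by
  have hκ1 : ∀ c, c ≠ 0 → w (κ c) = 1 := by
    intro c hc
    refine le_antisymm (hκ c) ?_
    have h1 : w (κ c) * w (κ c⁻¹) = 1 := by
      rw [← map_mul, ← map_mul, mul_inv_cancel₀ hc, RingHom.map_one, Valuation.map_one]
    calc (1 : ℤᵐ⁰) = w (κ c) * w (κ c⁻¹) := h1.symm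
      _ ≤ w (κ c) * 1 := by gcongr; exact hκ _
      _ = w (κ c) := mul_one _
  have hu0 : u ≠ 0 := by
    rintro rfl
    rw [map_zero] at hu
    exact exp_ne_zero hu.symm
  have hlt : ∀ x, w x < 1 → w x ≤ exp (-1 : ℤ) := by
    intro x hx
    rcases eq_or_ne (w x) 0 with h0 | h0
    · rw [h0]; exact zero_le
    · rw [← exp_log h0] at hx ⊢
      rw [← exp_zero, exp_lt_exp] at hx
      rw [exp_le_exp]; omega
  -- Here `m + 1 ≥ 1` is the valuation of `s`, the ramification index when `s` is a parameter on the
  -- base.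
  obtain ⟨m, η, hsη, hη⟩ : ∃ (m : ℕ) (η : M), s = u ^ (m + 1) * η ∧ w η = 1 := by
    have hws : w s ≠ 0 := (Valuation.ne_zero_iff w).2 hs0
    have h1 : log (w s) < 0 := by
      rw [← exp_log hws, ← exp_zero, exp_lt_exp] at hs
      exact hs
    obtain ⟨m, hm⟩ : ∃ m : ℕ, log (w s) = -((m + 1 : ℕ) : ℤ) :=
      ⟨(-log (w s)).toNat - 1, by omega⟩
    refine ⟨m, s / u ^ (m + 1), (mul_div_cancel₀ _ (pow_ne_zero _ hu0)).symm, ?_⟩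
    have h2 : w s = exp (-1 : ℤ) ^ (m + 1) := by
      rw [← exp_log hws, hm, ← exp_nsmul]
      congr 1
      simp
    rw [map_div₀, map_pow, hu, h2, div_self (pow_ne_zero _ exp_ne_zero)]
  -- Descent on the bound: if `θ` loses at most `n + 1` on the whole valuation ring, it loses at
  -- most `n`.
  induction N generalizing f with
  | zero => simpa using hN f hf
  | succ n ih =>
    refine ih (fun f hf => ?_) f hf
    -- Differentiating `s = u ^ (m + 1) * η` isolates `(m + 1) η uᵐ θ u`, and `m + 1` is a unit in
    -- characteristic zero. This is where tameness enters.
    have hθu : w (θ u) ≤ exp (n : ℤ) := by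
      have h1 : κ ((m : k) + 1) * η * u ^ m * θ u = θ s - u ^ (m + 1) * θ η := by
        rw [hsη, hθ, hθ.map_pow_succ]
        simp only [map_add, map_natCast, RingHom.map_one]
        ring
      have h2 := congrArg w h1
      rw [map_mul, map_mul, map_mul, map_pow, hu, hη, hκ1 _ (by exact_mod_cast m.succ_ne_zero),
        one_mul, one_mul] at h2
      have h3 : w (θ s - u ^ (m + 1) * θ η) ≤ exp (-1 : ℤ) ^ m * exp (n : ℤ) := by
        refine (w.map_sub _ _).trans (max_le ?_ ?_)
        · refine hθs.trans ?_
          rw [hsη, map_mul, hη, mul_one, map_pow, hu, pow_succ]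
          gcongr
          rw [exp_le_exp]; omega
        · rw [map_mul, map_pow, hu, pow_succ, mul_assoc]
          gcongr
          calc exp (-1 : ℤ) * w (θ η) ≤ exp (-1 : ℤ) * exp ((n + 1 : ℕ) : ℤ) := by
                gcongr; exact hN _ hη.le
            _ = exp (n : ℤ) := by rw [← exp_add]; congr 1; push_cast; ring
      rw [← h2] at h3
      exact (mul_le_mul_iff_right₀ (pow_pos exp_pos m)).1 h3
    -- Write `f = c + g u` with `g` in the valuation ring; then `θ f = g θ u + u θ g`, and the
    -- factor `u` absorbs one unit of the loss in `θ g`.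
    obtain ⟨c, hc⟩ := hres f hf
    set g := (f - κ c) / u with hg
    have hfg : f - κ c = g * u := (div_mul_cancel₀ _ hu0).symm
    have hwg : w g ≤ 1 := by
      rw [hg, map_div₀, hu]
      exact div_le_one_of_le₀ (hlt _ hc) zero_le
    have hθf : θ f = g * θ u + u * θ g := by
      rw [← hθ, ← hfg, map_sub, hθκ, sub_zero]
    rw [hθf]
    refine (w.map_add _ _).trans (max_le ?_ ?_)
    · rw [map_mul]
      calc w g * w (θ u) ≤ 1 * exp (n : ℤ) := by gcongr
        _ = _ := one_mul _
    · rw [map_mul, hu]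
      calc exp (-1 : ℤ) * w (θ g) ≤ exp (-1 : ℤ) * exp ((n + 1 : ℕ) : ℤ) := by
            gcongr; exact hN _ hwg
        _ = exp (n : ℤ) := by rw [← exp_add]; congr 1; push_cast; ring

end TameDerivation

/-! ### The derivation `X d/dX` on functions without poles over `X = 0` -/

section AtZero

variable {k : Type*} [Field k] [IsAlgClosed k] [CharZero k]
  {F : Type*} [Field F] [Algebra k[X] F] [IsFractionRing k[X] F]
  {M : Type*} [Field M] [Algebra F M] [FiniteDimensional F M]

omit [CharZero k] in
-- Modulo `P` the coefficients of an integral equation for `r` become their values at `0`, so the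
-- class of `r` is a root of a monic polynomial over the algebraically closed field `k`.
lemma exists_sub_mem_of_isIntegral {O : Type*} [CommRing O] [Algebra k[X] O]
    [Algebra.IsIntegral k[X] O] (P : Ideal O) [P.IsPrime] (hP : algebraMap k[X] O X ∈ P) (r : O) :
    ∃ c : k, r - algebraMap k[X] O (C c) ∈ P := by
  obtain ⟨p, hp, hpr⟩ := Algebra.IsIntegral.isIntegral (R := k[X]) r
  let π := Ideal.Quotient.mk P
  let κ : k →+* O ⧸ P := (π.comp (algebraMap k[X] O)).comp C
  have hκ : κ.comp (evalRingHom 0) = π.comp (algebraMap k[X] O) := by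
    refine Polynomial.ringHom_ext (fun c => by simp [κ]) ?_
    simp only [κ, RingHom.comp_apply, coe_evalRingHom, eval_X, map_zero]
    exact (Ideal.Quotient.eq_zero_iff_mem.2 hP).symm
  have h0 : ((p.map (evalRingHom 0)).map κ).IsRoot (π r) := by
    rw [IsRoot.def, Polynomial.map_map, hκ, Polynomial.eval_map, ← hom_eval₂, hpr, map_zero]
  obtain ⟨c, hc⟩ := (IsAlgClosed.splits (p.map (evalRingHom (0 : k)))).mem_range_of_isRoot
    ((hp.map _).ne_zero) h0
  exact ⟨c, Ideal.Quotient.eq.1 hc.symm⟩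

section Dedekind

variable {O : Type*} [CommRing O] [IsDedekindDomain O] [Algebra k[X] O] [Module.Finite k[X] O]
  [Algebra O M] [IsFractionRing O M]

omit [IsAlgClosed k] [CharZero k] in
open WithZero in
-- On `O` a bound for finitely many `k[X]`-module generators suffices, since `θ` maps `k[X]` into
-- itself. It passes to the valuation ring by the quotient rule, with denominators that are units at
-- `v`.
lemma IsLeibniz.exists_valuation_le_exp {θ : M →+ M} (hθ : IsLeibniz θ)
    (hθX : ∀ p : k[X], θ (algebraMap O M (algebraMap k[X] O p)) =
      algebraMap O M (algebraMap k[X] O (X * derivative p)))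
    (v : IsDedekindDomain.HeightOneSpectrum O) :
    ∃ N : ℕ, ∀ f : M, v.valuation M f ≤ 1 → v.valuation M (θ f) ≤ exp (N : ℤ) := by
  let w := v.valuation M
  have hO : ∀ f : O, w (algebraMap O M f) ≤ 1 := fun f => v.valuation_le_one f
  obtain ⟨N, hN⟩ : ∃ N : ℕ, ∀ f : O, w (θ (algebraMap O M f)) ≤ exp (N : ℤ) := by
    obtain ⟨m, b, hb⟩ := Module.Finite.exists_fin (R := k[X]) (M := O)
    have hexp : ∀ a : ℤᵐ⁰, ∃ n : ℕ, a ≤ exp (n : ℤ) := by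
      intro a
      rcases eq_or_ne a 0 with rfl | ha
      · exact ⟨0, zero_le⟩
      · refine ⟨(log a).toNat, ?_⟩
        rw [← exp_log ha, exp_le_exp, log_exp]
        exact Int.self_le_toNat _
    choose n hn using fun i => hexp (w (θ (algebraMap O M (b i))))
    refine ⟨Finset.univ.sup n, fun f => ?_⟩
    have hf : f ∈ Submodule.span k[X] (Set.range b) := by rw [hb]; trivial
    induction hf using Submodule.span_induction with
    | mem f hf =>
      obtain ⟨i, rfl⟩ := hf
      refine (hn i).trans ?_
      rw [exp_le_exp]
      exact_mod_cast Finset.le_sup (Finset.mem_univ i)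
    | zero => rw [map_zero, map_zero, map_zero]; exact zero_le
    | add f g _ _ hf hg =>
      rw [map_add, map_add]
      exact (w.map_add _ _).trans (max_le hf hg)
    | smul p f _ hf =>
      rw [Algebra.smul_def, map_mul, hθ, hθX, ← map_mul]
      refine (w.map_add _ _).trans (max_le ?_ ?_)
      · rw [map_mul]
        calc _ ≤ 1 * exp _ := by gcongr; exact hO _
          _ = _ := one_mul _
      · refine (hO _).trans ?_
        rw [← exp_zero, exp_le_exp]; positivity
  refine ⟨N, fun f hf => ?_⟩
  obtain ⟨n, ⟨d, hd⟩, hnd⟩ := v.exists_primeCompl_mul_eq_of_integer f hf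
  have hwd : w (algebraMap O M d) = 1 := v.valuation_eq_one_iff_notMem.2 hd
  have h1 : algebraMap O M d * θ f = θ (algebraMap O M n) - f * θ (algebraMap O M d) := by
    rw [eq_sub_iff_add_eq, ← hnd, hθ, add_comm]
  have h2 := congrArg w h1
  rw [map_mul, hwd, one_mul] at h2
  rw [h2]
  refine (w.map_sub _ _).trans (max_le (hN n) ?_)
  rw [map_mul]
  calc _ ≤ 1 * exp (N : ℤ) := by gcongr; exact hN d
    _ = _ := one_mul _

/-- This is `IsLeibniz.valuation_le_one` with `s = X`, for which `θ X = X`; the residue field at `v`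
is `k`. -/
lemma IsLeibniz.valuation_le_one_of_X_mem {θ : M →+ M} (hθ : IsLeibniz θ)
    (hθX : ∀ p : k[X], θ (algebraMap O M (algebraMap k[X] O p)) =
      algebraMap O M (algebraMap k[X] O (X * derivative p)))
    (hX : algebraMap k[X] O X ≠ 0) (v : IsDedekindDomain.HeightOneSpectrum O)
    (hv : algebraMap k[X] O X ∈ v.asIdeal) {f : M} (hf : v.valuation M f ≤ 1) :
    v.valuation M (θ f) ≤ 1 := by
  let w := v.valuation M
  have hP : v.asIdeal.IsPrime := v.isPrime
  obtain ⟨u, hu⟩ := v.valuation_exists_uniformizer M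
  obtain ⟨N, hN⟩ := hθ.exists_valuation_le_exp hθX v
  refine hθ.valuation_le_one (k := k) w ((algebraMap O M).comp ((algebraMap k[X] O).comp C))
    (fun c => v.valuation_le_one _) (fun c => ?_) hu
    ((map_ne_zero_iff _ (IsFractionRing.injective O M)).2 hX)
    ((v.valuation_lt_one_iff_mem _).2 hv) ?_ (fun f hf => ?_) N hN f hf
  · refine (hθX (C c)).trans ?_
    rw [derivative_C, mul_zero, map_zero, map_zero]
  · rw [hθX, derivative_X, mul_one]
  · obtain ⟨r, hr⟩ := v.exists_valuation_sub_lt_of_integer hf 1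
    obtain ⟨c, hc⟩ := exists_sub_mem_of_isIntegral v.asIdeal hv r
    refine ⟨c, ?_⟩
    have h1 : w (algebraMap O M (r - algebraMap k[X] O (C c))) < 1 :=
      (v.valuation_lt_one_iff_mem _).2 hc
    have h2 : f - ((algebraMap O M).comp ((algebraMap k[X] O).comp C)) c =
        algebraMap O M (r - algebraMap k[X] O (C c)) - (algebraMap O M r - f) := by
      rw [map_sub]
      simp only [RingHom.comp_apply]
      ring
    rw [h2]
    exact (w.map_sub _ _).trans_lt (max_lt h1 hr)

end Dedekind

/-- The subring of functions without poles over `X = 0`: it is preserved by `X d/dX`. -/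
lemma exists_subring_forall_derivation_mem {θ : M →+ M} (hθ : IsLeibniz θ)
    (hθX : ∀ p : k[X], θ (algebraMap F M (algebraMap k[X] F p)) =
      algebraMap F M (algebraMap k[X] F (X * derivative p))) :
    ∃ S : Subring M,
      (∀ f, ((algebraMap F M).comp (algebraMap k[X] F)).IsIntegralElem f → f ∈ S) ∧
      (∀ f ∈ S, θ f ∈ S) ∧
      ∀ f ∈ S, ∀ n : ℕ, ((algebraMap F M).comp (algebraMap k[X] F)).IsIntegralElem
        (algebraMap F M (algebraMap k[X] F X) ^ n * f) →
        ((algebraMap F M).comp (algebraMap k[X] F)).IsIntegralElem f := by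
  let := ((algebraMap F M).comp (algebraMap k[X] F)).toAlgebra
  have : IsScalarTower k[X] F M := IsScalarTower.of_algebraMap_eq fun _ => rfl
  have : CharZero F := charZero_of_injective_algebraMap
    (IsFractionRing.injective k[X] F)
  let O := integralClosure k[X] M
  have hfr : IsFractionRing O M := integralClosure.isFractionRing_of_finite_extension F M
  have hdd : IsDedekindDomain O := integralClosure.isDedekindDomain k[X] F M
  have hfin : Module.Finite k[X] O := IsIntegralClosure.finite k[X] F M O
  let x : O := algebraMap k[X] O X
  have hx0 : x ≠ 0 := by
    intro h
    have h1 : algebraMap F M (algebraMap k[X] F X) = 0 := congrArg (algebraMap O M) h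
    exact X_ne_zero ((map_eq_zero_iff _ (IsFractionRing.injective k[X] F)).1
      ((_root_.map_eq_zero _).1 h1))
  have hxM : algebraMap O M x = algebraMap F M (algebraMap k[X] F X) := rfl
  have hθX' : ∀ p : k[X], θ (algebraMap O M (algebraMap k[X] O p)) =
      algebraMap O M (algebraMap k[X] O (X * derivative p)) := hθX
  let I := {v : IsDedekindDomain.HeightOneSpectrum O // x ∈ v.asIdeal}
  let S : Subring M := ⨅ v : I, (v.1.valuation M).integer
  have hmemS : ∀ f, f ∈ S ↔ ∀ v : I, v.1.valuation M f ≤ 1 := fun f => by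
    simp only [S, Subring.mem_iInf, Valuation.mem_integer_iff]
  have hO : ∀ (v : IsDedekindDomain.HeightOneSpectrum O) (f : M),
      ((algebraMap F M).comp (algebraMap k[X] F)).IsIntegralElem f → v.valuation M f ≤ 1 :=
    fun v f hf => v.valuation_le_one (⟨f, hf⟩ : O)
  refine ⟨S, fun f hf => ?_, fun f hf => ?_, fun f hf n hfn => ?_⟩
  · rw [hmemS]
    exact fun v => hO v.1 f hf
  · rw [hmemS] at hf ⊢
    exact fun v => hθ.valuation_le_one_of_X_mem (O := O) hθX' hx0 v.1 v.2 (hf v)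
  · rw [hmemS] at hf
    -- Over `X = 0` integrality comes from membership in `S`; elsewhere `X` is a unit, so
    -- multiplying by `Xⁿ` changes nothing.
    have hle : ∀ v : IsDedekindDomain.HeightOneSpectrum O, v.valuation M f ≤ 1 := by
      intro v
      by_cases hv : x ∈ v.asIdeal
      · exact hf ⟨v, hv⟩
      · have hx : v.valuation M (algebraMap O M x) = 1 := v.valuation_eq_one_iff_notMem.2 hv
        rw [hxM] at hx
        have := hO v _ hfn
        rwa [map_mul, map_pow, hx, one_pow, one_mul] at this
    obtain ⟨g, hg⟩ :=
      IsDedekindDomain.HeightOneSpectrum.mem_integers_of_valuation_le_one (R := O) M f hle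
    rw [← hg]
    exact g.2

end AtZero

end CurveCover
namespace CurveCover

open Polynomial

/-! ### The charts with coordinate `(X - α)⁻¹` -/

section Charts

lemma eval₂_mul_pow_eq_eval₂_reverse {R S : Type*} [CommRing R] [CommRing S] (i : R →+* S)
    {x y : S} (hxy : x * y = 1) (p : R[X]) :
    eval₂ i x p * y ^ p.natDegree = eval₂ i y (reverse p) := by
  let : Invertible x := ⟨y, by rw [mul_comm, hxy], hxy⟩
  have h := eval₂_reverse_mul_pow i x p
  rw [← h, mul_assoc, ← mul_pow, hxy, one_pow, mul_one]
  rfl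

variable {k : Type*} [Field k] {F : Type*} [Field F] [Algebra k[X] F] [IsFractionRing k[X] F]

variable (F) in
/-- The coordinate ring of the chart of the projective line with coordinate `(X - α)⁻¹`. -/
noncomputable def invChart (α : k) : k[X] →+* F :=
  eval₂RingHom ((algebraMap k[X] F).comp C) (algebraMap k[X] F (X - C α))⁻¹

omit [IsFractionRing k[X] F] in
lemma invChart_C (α c : k) : invChart F α (C c) = algebraMap k[X] F (C c) := by
  simp [invChart]

omit [IsFractionRing k[X] F] in
lemma invChart_X (α : k) : invChart F α X = (algebraMap k[X] F (X - C α))⁻¹ := by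
  simp [invChart]

lemma algebraMap_X_sub_C_ne_zero (α : k) : algebraMap k[X] F (X - C α) ≠ 0 :=
  (map_ne_zero_iff _ (IsFractionRing.injective k[X] F)).2 (X_sub_C_ne_zero α)

/-- A nonzero polynomial killed by the map would have `(X - α)⁻¹` among its roots, all of which lie
in `k`. -/
lemma invChart_injective [IsAlgClosed k] (α : k) : Function.Injective (invChart F α) := by
  rw [injective_iff_map_eq_zero]
  intro p hp
  by_contra hp0
  have h1 : (p.map ((algebraMap k[X] F).comp C)).IsRoot (algebraMap k[X] F (X - C α))⁻¹ := by
    rw [IsRoot.def, Polynomial.eval_map]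
    exact hp
  obtain ⟨c, hc⟩ := (IsAlgClosed.splits p).mem_range_of_isRoot hp0 h1
  have h2 : algebraMap k[X] F (X - C α) = algebraMap k[X] F (C c⁻¹) := by
    rw [← inv_inv (algebraMap k[X] F (X - C α)), ← hc, RingHom.comp_apply]
    refine inv_eq_of_mul_eq_one_right ?_
    rw [← map_mul, ← C_mul, mul_inv_cancel₀, C_1, map_one]
    rintro rfl
    simp only [map_zero] at hc
    exact algebraMap_X_sub_C_ne_zero α (inv_eq_zero.1 hc.symm)
  have h3 := congrArg natDegree (IsFractionRing.injective k[X] F h2)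
  simp at h3

/-- This makes every result about the coordinate `X` available for the coordinate `(X - α)⁻¹`, by
switching the `k[X]`-algebra structure on `F`. -/
lemma isFractionRing_invChart [IsAlgClosed k] (α : k) :
    @IsFractionRing k[X] _ F _ (invChart F α).toAlgebra := by
  let L := (IsFractionRing.lift (K := FractionRing k[X]) (invChart_injective (F := F) α)).fieldRange
  have hL : ∀ p, invChart F α p ∈ L := fun p =>
    ⟨algebraMap k[X] _ p, IsFractionRing.lift_algebraMap _ p⟩
  have hL' : ∀ p : k[X], algebraMap k[X] F p ∈ L := by
    have hC : ∀ c : k, algebraMap k[X] F (C c) ∈ L := fun c => by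
      rw [← invChart_C α]; exact hL _
    have hX : algebraMap k[X] F X ∈ L := by
      have h1 := L.inv_mem (hL X)
      rw [invChart_X, inv_inv] at h1
      have h2 := L.add_mem h1 (hC α)
      rwa [← map_add, sub_add_cancel] at h2
    intro p
    induction p using Polynomial.induction_on' with
    | add p q hp hq => rw [map_add]; exact L.add_mem hp hq
    | monomial n a =>
      rw [← C_mul_X_pow_eq_monomial, map_mul, map_pow]
      exact L.mul_mem (hC a) (L.pow_mem hX n)
  have hz : ∀ z, z ∈ L := fun z => by
    obtain ⟨a, b, -, rfl⟩ := IsFractionRing.div_surjective (A := k[X]) z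
    exact L.div_mem (hL' a) (hL' b)
  have hinj := invChart_injective (F := F) α
  have hdiv : ∀ z, ∃ x y, z = invChart F α x / invChart F α y := fun z => by
    obtain ⟨y, rfl⟩ := hz z
    obtain ⟨a, b, -, rfl⟩ := IsFractionRing.div_surjective (A := k[X]) y
    exact ⟨a, b, by rw [map_div₀, IsFractionRing.lift_algebraMap, IsFractionRing.lift_algebraMap]⟩
  let alg := (invChart F α).toAlgebra
  have : @FaithfulSMul k[X] F alg.toSMul :=
    (@faithfulSMul_iff_algebraMap_injective k[X] F _ _ alg).2 hinj
  exact @IsFractionRing.of_field k[X] _ F _ alg this hdiv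

lemma pow_mul_mem_range_invChart (p : k[X]) {n : ℕ} (hn : p.natDegree ≤ n) :
    invChart F (0 : k) X ^ n * algebraMap k[X] F p ∈ (invChart F (0 : k)).range := by
  have h0 : algebraMap k[X] F X * invChart F (0 : k) X = 1 := by
    rw [invChart_X, C_0, sub_zero, mul_inv_cancel₀]
    simp
  have h1 : algebraMap k[X] F p = eval₂ ((algebraMap k[X] F).comp C) (algebraMap k[X] F X) p := by
    rw [← hom_eval₂, eval₂_C_X]
  refine ⟨X ^ (n - p.natDegree) * reverse p, ?_⟩
  have h2 := eval₂_mul_pow_eq_eval₂_reverse ((algebraMap k[X] F).comp C) h0 p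
  have h3 : invChart F 0 (reverse p) =
      eval₂ ((algebraMap k[X] F).comp C) (invChart F (0 : k) X) (reverse p) := by
    rw [invChart_X]; rfl
  rw [map_mul, map_pow, h3, ← h2, ← h1, ← mul_assoc, mul_right_comm, ← pow_add,
    Nat.sub_add_cancel hn]

/-- If `p = q(1/X)`, then `p * X ^ deg q` is the reverse of `q`, of degree at most `deg q`; so `p`
has degree zero. -/
lemma exists_C_of_mem_range_of_mem_range_invChart {y : F} (h1 : y ∈ (algebraMap k[X] F).range)
    (h2 : y ∈ (invChart F (0 : k)).range) : ∃ c : k, y = algebraMap k[X] F (C c) := by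
  obtain ⟨p, rfl⟩ := h1
  obtain ⟨q, hq⟩ := h2
  have h0 : invChart F (0 : k) X * algebraMap k[X] F X = 1 := by
    rw [invChart_X, C_0, sub_zero, inv_mul_cancel₀]
    simp
  have h3 := eval₂_mul_pow_eq_eval₂_reverse ((algebraMap k[X] F).comp C) h0 q
  have h4 : invChart F 0 q =
      eval₂ ((algebraMap k[X] F).comp C) (invChart F (0 : k) X) q := by
    rw [invChart_X]; rfl
  rw [← h4, hq, ← hom_eval₂, eval₂_C_X, ← map_pow, ← map_mul] at h3
  have h5 := IsFractionRing.injective k[X] F h3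
  have hp : p.natDegree = 0 := by
    rcases eq_or_ne p 0 with rfl | hp
    · simp
    · have := congrArg natDegree h5
      rw [natDegree_mul hp (pow_ne_zero _ X_ne_zero), natDegree_X_pow] at this
      have := reverse_natDegree_le q
      omega
  exact ⟨p.coeff 0, by rw [← eq_C_of_natDegree_eq_zero hp]⟩

end Charts

/-! ### Simple connectedness of the affine line -/

section SimplyConnected

lemma IsLeibniz.map_eval₂ {R A : Type*} [CommRing R] [CommRing A] {D : A →+ A} (hD : IsLeibniz D)
    (i : R →+* A) (hi : ∀ r, D (i r) = 0) (x : A) (p : R[X]) :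
    D (eval₂ i x p) = eval₂ i x (derivative p) * D x := by
  induction p using Polynomial.induction_on' with
  | add p q hp hq => rw [eval₂_add, map_add, hp, hq, derivative_add, eval₂_add, add_mul]
  | monomial n a =>
    rw [eval₂_monomial, hD, hi, mul_zero, add_zero, derivative_monomial, eval₂_monomial]
    cases n with
    | zero => simp [hD.map_one]
    | succ n => rw [hD.map_pow_succ, map_mul, map_natCast, Nat.add_sub_cancel]; push_cast; ring

lemma exists_derivative_eq {k : Type*} [Field k] [CharZero k] (p : k[X]) :
    ∃ q : k[X], derivative q = p := by
  induction p using Polynomial.induction_on' with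
  | add p q hp hq =>
    obtain ⟨a, rfl⟩ := hp
    obtain ⟨b, rfl⟩ := hq
    exact ⟨a + b, derivative_add⟩
  | monomial n a =>
    refine ⟨monomial (n + 1) (a / (n + 1)), ?_⟩
    rw [derivative_monomial, Nat.add_sub_cancel]
    congr 1
    push_cast
    exact div_mul_cancel₀ _ (by exact_mod_cast n.succ_ne_zero)

variable {k : Type*} [Field k] {F : Type*} [Field F] [Algebra k[X] F] [IsFractionRing k[X] F]
  {M : Type*} [Field M] [Algebra F M]

lemma coeff_minpoly_mem_range {f : M}
    (hf : ((algebraMap F M).comp (algebraMap k[X] F)).IsIntegralElem f) (n : ℕ) :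
    (minpoly F f).coeff n ∈ (algebraMap k[X] F).range := by
  let := ((algebraMap F M).comp (algebraMap k[X] F)).toAlgebra
  have : IsScalarTower k[X] F M := IsScalarTower.of_algebraMap_eq fun _ => rfl
  have hf' : IsIntegral k[X] f := hf
  rw [minpoly.isIntegrallyClosed_eq_field_fractions' F hf', coeff_map]
  exact ⟨_, rfl⟩

/-- An element integral over `k[X]` has a pole of bounded order at infinity. -/
lemma isIntegralElem_pow_mul_invChart {f : M}
    (hf : ((algebraMap F M).comp (algebraMap k[X] F)).IsIntegralElem f) :
    ∃ n : ℕ, ((algebraMap F M).comp (invChart F (0 : k))).IsIntegralElem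
      (algebraMap F M (invChart F (0 : k) X) ^ n * f) := by
  obtain ⟨p, hp, hpf⟩ := hf
  -- Scaling the roots by `s = X⁻ᴺ` multiplies the `i`-th coefficient by `s ^ (deg p - i)`; for `i <
  -- deg p` this clears its pole at infinity, of order at most `N`.
  let N := p.support.sup fun i => (p.coeff i).natDegree
  let s : F := invChart F (0 : k) X ^ N
  let q := scaleRoots (p.map (algebraMap k[X] F)) s
  have hq : q.Monic := (monic_scaleRoots_iff s).2 (hp.map _)
  have hdeg : (p.map (algebraMap k[X] F)).natDegree = p.natDegree := hp.natDegree_map _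
  have hql : q ∈ lifts (invChart F (0 : k)) := by
    rw [lifts_iff_coeff_lifts]
    intro i
    rw [coeff_scaleRoots, hdeg, coeff_map]
    rcases lt_or_ge i p.natDegree with hi | hi
    · rw [← pow_mul, mul_comm]
      refine pow_mul_mem_range_invChart _ ?_
      by_cases hi' : i ∈ p.support
      · calc (p.coeff i).natDegree ≤ N := Finset.le_sup (f := fun i => (p.coeff i).natDegree) hi'
          _ ≤ N * (p.natDegree - i) := Nat.le_mul_of_pos_right _ (by omega)
      · rw [notMem_support_iff.1 hi']; simp
    · rw [Nat.sub_eq_zero_of_le hi, pow_zero, mul_one]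
      rcases hi.eq_or_lt with rfl | hi
      · rw [hp.coeff_natDegree]; exact ⟨1, by simp⟩
      · rw [coeff_eq_zero_of_natDegree_lt hi]; exact ⟨0, by simp⟩
  obtain ⟨r, hr, -, hrm⟩ := lifts_and_natDegree_eq_and_monic hql hq
  refine ⟨N, r, hrm, ?_⟩
  rw [← eval₂_map, hr, ← map_pow]
  refine scaleRoots_eval₂_eq_zero _ ?_
  rw [eval₂_map]
  exact hpf

variable [IsAlgClosed k] [CharZero k] [FiniteDimensional F M]

omit [IsAlgClosed k] in
-- The expansion of `f` at `0` has zero derivative, hence is constant in characteristic zero, and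
-- the expansion map is injective.
lemma exists_C_of_derivation_eq_zero
    (hsplit : ∀ c : k, ∀ j : F →+* LaurentField k, IsExpansionAt c j → SplitAlong j M)
    {D : M →+ M} (hD : IsLeibniz D) (hDX : ∀ p : k[X], D (algebraMap F M (algebraMap k[X] F p)) =
      algebraMap F M (algebraMap k[X] F (derivative p)))
    {f : M} (hf : ((algebraMap F M).comp (algebraMap k[X] F)).IsIntegralElem f) (hDf : D f = 0) :
    ∃ c : k, f = algebraMap F M (algebraMap k[X] F (C c)) := by
  obtain ⟨j, hj⟩ := exists_isExpansionAt F (0 : k)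
  set Ω := AlgebraicClosure (LaurentField k)
  let : Algebra F Ω := ((algebraMap (LaurentField k) Ω).comp j).toAlgebra
  let φ : M →ₐ[F] Ω := IsAlgClosed.lift
  have hφ : φ.toRingHom.comp (algebraMap F M) = (algebraMap (LaurentField k) Ω).comp j :=
    RingHom.ext fun x => φ.commutes x
  obtain ⟨g, hg, hg'⟩ := exists_expansion hj (hsplit 0 j hj) hD hDX hf φ.toRingHom hφ
  rw [hDf, map_zero, map_eq_zero_iff _ (algebraMap (LaurentField k) Ω).injective,
    map_eq_zero_iff _ (IsFractionRing.injective (PowerSeries k) (LaurentField k))] at hg'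
  have hgC : g = PowerSeries.C (PowerSeries.constantCoeff g) :=
    PowerSeries.derivative.ext (by rw [hg', PowerSeries.derivative_C]) (by simp)
  refine ⟨PowerSeries.constantCoeff g, φ.toRingHom.injective ?_⟩
  rw [← hg]
  have h1 := congrArg (fun u => u (algebraMap k[X] F (C (PowerSeries.constantCoeff g)))) hφ
  refine Eq.trans ?_ h1.symm
  rw [RingHom.comp_apply, hj, aeval_C, hgC]
  simp only [PowerSeries.constantCoeff_C]
  rfl

omit [IsAlgClosed k] [CharZero k] in
lemma mem_range_of_algebraMap_surjective_on_integral
    (h : ∀ f : M, ((algebraMap F M).comp (algebraMap k[X] F)).IsIntegralElem f →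
      ∃ p : k[X], f = algebraMap F M (algebraMap k[X] F p)) (m : M) :
    m ∈ (algebraMap F M).range := by
  let := ((algebraMap F M).comp (algebraMap k[X] F)).toAlgebra
  have : IsScalarTower k[X] F M := IsScalarTower.of_algebraMap_eq fun _ => rfl
  obtain ⟨⟨b, hb⟩, hm⟩ := IsIntegral.exists_multiple_integral_of_isLocalization
    (nonZeroDivisors k[X]) (Rₘ := F) m (Algebra.IsIntegral.isIntegral m)
  obtain ⟨p, hp⟩ := h _ hm
  have hb0 : algebraMap k[X] F b ≠ 0 := IsFractionRing.to_map_ne_zero_of_mem_nonZeroDivisors hb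
  refine ⟨algebraMap k[X] F p / algebraMap k[X] F b, ?_⟩
  rw [map_div₀, ← hp, div_eq_iff ((_root_.map_ne_zero _).2 hb0), mul_comm]
  exact Algebra.smul_def b m

/-- The affine line over an algebraically closed field of characteristic zero is simply
connected: a finite extension of `k(X)` that splits at every point of the affine line is
trivial. -/
theorem algebraMap_surjective_of_splitAlong
    (hsplit : ∀ c : k, ∀ j : F →+* LaurentField k, IsExpansionAt c j → SplitAlong j M) :
    Function.Surjective (algebraMap F M) := by
  have hCF : CharZero F := charZero_of_injective_algebraMap (IsFractionRing.injective k[X] F)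
  obtain ⟨D, hD, hDX⟩ : ∃ D : M →+ M, IsLeibniz D ∧
      ∀ p : k[X], D (algebraMap F M (algebraMap k[X] F p)) =
        algebraMap F M (algebraMap k[X] F (derivative p)) := by
    let := ((algebraMap F M).comp (algebraMap k[X] F)).toAlgebra
    have : IsScalarTower k[X] F M := IsScalarTower.of_algebraMap_eq fun _ => rfl
    have : Algebra.FormallyEtale F M := Algebra.FormallyEtale.of_isSeparable F M
    have : Algebra.FormallyEtale k[X] F :=
      Algebra.FormallyEtale.of_isLocalization (nonZeroDivisors k[X])
    have : Algebra.FormallyEtale k[X] M := Algebra.FormallyEtale.comp k[X] F M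
    exact exists_isLeibniz_of_formallyEtale k[X] M
      (derivative (R := k)).toAddMonoidHom fun x y => by
        change derivative (x * y) = x * derivative y + y * derivative x
        rw [derivative_mul]; ring
  set t : M := algebraMap F M (algebraMap k[X] F X) with ht
  set s : M := algebraMap F M (invChart F (0 : k) X) with hs
  have hts : t * s = 1 := by
    rw [ht, hs, ← map_mul, invChart_X, C_0, sub_zero, mul_inv_cancel₀, map_one]
    simp
  let κ : k →+* M := (algebraMap F M).comp ((algebraMap k[X] F).comp C)
  have hDκ : ∀ c, D (κ c) = 0 := fun c => (hDX (C c)).trans (by simp)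
  have hDt : D t = 1 := (hDX X).trans (by simp)
  -- In the parameter `s = 1/t` at infinity this is `s d/ds`.
  let θ : M →+ M := (AddMonoidHom.mulLeft (-t)).comp D
  have hθD : ∀ f, θ f = -t * D f := fun _ => rfl
  have hθ : IsLeibniz θ := fun x y => by rw [hθD, hθD, hθD, hD]; ring
  have hθs : θ s = s := by
    have h1 := hD t s
    rw [hts, hD.map_one, hDt, mul_one] at h1
    rw [hθD]
    linear_combination h1
  obtain ⟨S, hS1, hS2, hS3⟩ : ∃ S : Subring M,
      (∀ f, ((algebraMap F M).comp (invChart F (0 : k))).IsIntegralElem f → f ∈ S) ∧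
      (∀ f ∈ S, θ f ∈ S) ∧
      ∀ f ∈ S, ∀ n : ℕ, ((algebraMap F M).comp (invChart F (0 : k))).IsIntegralElem (s ^ n * f) →
        ((algebraMap F M).comp (invChart F (0 : k))).IsIntegralElem f := by
    have hθX : ∀ p : k[X], θ (algebraMap F M (invChart F 0 p)) =
        algebraMap F M (invChart F 0 (X * derivative p)) := by
      have h1 : ∀ p : k[X], algebraMap F M (invChart F 0 p) = eval₂ κ s p := fun p => by
        rw [invChart, coe_eval₂RingHom, hom_eval₂, hs, invChart_X]
      intro p
      rw [h1, hθ.map_eval₂ κ (fun c => by rw [hθD, hDκ, mul_zero]), hθs, map_mul, map_mul,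
        h1 (derivative p), mul_comm]
    have hfr := isFractionRing_invChart (F := F) (0 : k)
    let := (invChart F (0 : k)).toAlgebra
    exact exists_subring_forall_derivation_mem (k := k) (F := F) hθ hθX
  have hint : ∀ (n : ℕ) (f : M), ((algebraMap F M).comp (algebraMap k[X] F)).IsIntegralElem f →
      ((algebraMap F M).comp (algebraMap k[X] F)).IsIntegralElem (D^[n] f) := by
    intro n
    induction n with
    | zero => exact fun f hf => hf
    | succ n ih => exact fun f hf => ih _ (isIntegralElem_derivation hsplit hD hDX hf)
  have hsS : s ∈ S := hS1 _ (RingHom.isIntegralElem_map _)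
  -- Each `D` gains a power of `s`, by `sⁿ D f = (n + 1) sⁿ⁺¹ f - θ (sⁿ⁺¹ f)` and the stability of
  -- `S` under `θ`.
  have hlower : ∀ (n : ℕ) (f : M), s ^ n * f ∈ S → D^[n] f ∈ S := by
    intro n
    induction n with
    | zero => intro f hf; simpa using hf
    | succ n ih =>
      refine fun f hf => ih _ ?_
      have h1 : s ^ n * D f = (n + 1) * (s ^ (n + 1) * f) - θ (s ^ (n + 1) * f) := by
        rw [hθ, hθ.map_pow_succ, hθs, hθD]
        linear_combination (-s ^ n * D f) * hts
      rw [h1]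
      exact S.sub_mem (S.mul_mem (by exact_mod_cast natCast_mem S (n + 1)) hf) (hS2 _ hf)
  -- Such an `f` is integral over both charts, so its minimal polynomial has coefficients regular on
  -- the whole line, hence in `k`; thus `f` itself lies in `k`.
  have hconst : ∀ f ∈ S, ((algebraMap F M).comp (algebraMap k[X] F)).IsIntegralElem f →
      D f = 0 := by
    intro f hfS hf
    obtain ⟨n, hn⟩ := isIntegralElem_pow_mul_invChart hf
    have hf' := hS3 f hfS n hn
    have hcoef : ∀ n, (minpoly F f).coeff n ∈ (invChart F (0 : k)).range := by
      have hfr := isFractionRing_invChart (F := F) (0 : k)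
      let := (invChart F (0 : k)).toAlgebra
      exact coeff_minpoly_mem_range (k := k) hf'
    have hl : minpoly F f ∈ lifts ((algebraMap k[X] F).comp C) := by
      rw [lifts_iff_coeff_lifts]
      intro n
      obtain ⟨c, hc⟩ :=
        exists_C_of_mem_range_of_mem_range_invChart (coeff_minpoly_mem_range hf n) (hcoef n)
      exact ⟨c, hc.symm⟩
    obtain ⟨q, hq⟩ := (mem_lifts _).1 hl
    have hq0 : q ≠ 0 := by
      rintro rfl
      rw [Polynomial.map_zero] at hq
      exact minpoly.ne_zero (Algebra.IsIntegral.isIntegral (R := F) f) hq.symm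
    have hroot : (q.map κ).IsRoot f := by
      rw [show κ = (algebraMap F M).comp ((algebraMap k[X] F).comp C) from rfl,
        ← Polynomial.map_map, hq, IsRoot.def, eval_map_algebraMap]
      exact minpoly.aeval F f
    obtain ⟨c, rfl⟩ := (IsAlgClosed.splits q).mem_range_of_isRoot hq0 hroot
    exact hDκ c
  have hpoly : ∀ (n : ℕ) (f : M), ((algebraMap F M).comp (algebraMap k[X] F)).IsIntegralElem f →
      D^[n] f = 0 → ∃ p : k[X], f = algebraMap F M (algebraMap k[X] F p) := by
    intro n
    induction n with
    | zero => exact fun f _ h => ⟨0, by simpa using h⟩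
    | succ n ih =>
      intro f hf h
      obtain ⟨p, hp⟩ := ih (D f) (isIntegralElem_derivation hsplit hD hDX hf) h
      obtain ⟨q, rfl⟩ := exists_derivative_eq p
      obtain ⟨c, hc⟩ := exists_C_of_derivation_eq_zero hsplit hD hDX
        (f := f - algebraMap F M (algebraMap k[X] F q))
        (hf.sub _ (RingHom.isIntegralElem_map ((algebraMap F M).comp (algebraMap k[X] F))))
        (by rw [map_sub, hDX, hp, sub_self])
      exact ⟨q + C c, by rw [map_add, map_add, ← hc]; ring⟩
  intro m
  refine mem_range_of_algebraMap_surjective_on_integral (k := k) (fun f hf => ?_) m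
  obtain ⟨n, hn⟩ := isIntegralElem_pow_mul_invChart hf
  -- After `n` derivatives the pole at infinity is gone and a constant is left; one more derivative
  -- kills it.
  refine hpoly (n + 1) f hf ?_
  rw [Function.iterate_succ_apply']
  exact hconst _ (hlower n f (hS1 _ hn)) (hint n f hf)

end SimplyConnected

end CurveCover
namespace CurveCover

open Polynomial

/-! ### Disjoint normal closures and Galois groups -/

section Galois

open IntermediateField Module

variable {F : Type*} [Field F]

/-- The normal closures of `K₁` and `K₂` over `F` are linearly disjoint, in the sense that they
meet in `F` inside every algebraic closure of `F`. -/
def NormalClosuresDisjoint (F K₁ K₂ : Type) [Field F] [Field K₁] [Field K₂] [Algebra F K₁]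
    [Algebra F K₂] : Prop :=
  ∀ (E : Type) [Field E] [Algebra F E] [IsAlgClosed E] [Algebra.IsAlgebraic F E],
    normalClosure F K₁ E ⊓ normalClosure F K₂ E = ⊥

lemma normal_of_isAlgClosed (F E : Type*) [Field F] [Field E] [Algebra F E] [IsAlgClosed E]
    [Algebra.IsAlgebraic F E] : Normal F E :=
  have : IsAlgClosure F E := ⟨inferInstance, inferInstance⟩
  IsAlgClosure.normal F E

/-- The intersection of the normal closures embeds in each of them, so it splits at `c` as soon as
one of `K₁`, `K₂` does. -/
lemma normalClosuresDisjoint_of_splitAlong {k : Type*} [Field k] [IsAlgClosed k] [CharZero k]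
    {F K₁ K₂ : Type} [Field F] [Field K₁] [Field K₂] [Algebra F K₁] [Algebra F K₂]
    [Algebra k[X] F] [IsFractionRing k[X] F] [FiniteDimensional F K₁] [FiniteDimensional F K₂]
    (h : ∀ c : k, ∀ j : F →+* LaurentField k, IsExpansionAt c j →
      SplitAlong j K₁ ∨ SplitAlong j K₂) :
    NormalClosuresDisjoint F K₁ K₂ := by
  intro E _ _ _ _
  let M := normalClosure F K₁ E ⊓ normalClosure F K₂ E
  have hM : FiniteDimensional F M :=
    Module.Finite.of_injective (IntermediateField.inclusion (inf_le_left : M ≤ _)).toLinearMap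
      (IntermediateField.inclusion (inf_le_left : M ≤ _)).injective
  have hsurj : Function.Surjective (algebraMap F M) := by
    refine algebraMap_surjective_of_splitAlong (k := k) fun c j hj => ?_
    rcases h c j hj with h | h
    · exact (h.normalClosure E).of_algHom (IntermediateField.inclusion inf_le_left)
    · exact (h.normalClosure E).of_algHom (IntermediateField.inclusion inf_le_right)
  rw [eq_bot_iff]
  intro x hx
  obtain ⟨y, hy⟩ := hsurj ⟨x, hx⟩
  exact ⟨y, congrArg Subtype.val hy⟩

lemma NormalClosuresDisjoint.isDomain_tensorProduct {F K₁ K₂ : Type} [Field F] [CharZero F]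
    [Field K₁] [Field K₂] [Algebra F K₁] [Algebra F K₂] [FiniteDimensional F K₁]
    [FiniteDimensional F K₂] (h : NormalClosuresDisjoint F K₁ K₂) :
    IsDomain (TensorProduct F K₁ K₂) := by
  let E := AlgebraicClosure F
  have := normal_of_isAlgClosed F E
  let f₁ : K₁ →ₐ[F] E := IsAlgClosed.lift
  let f₂ : K₂ →ₐ[F] E := IsAlgClosed.lift
  have hd : (normalClosure F K₁ E).LinearDisjoint (normalClosure F K₂ E) :=
    LinearDisjoint.of_inf_eq_bot (h E)
  exact (hd.of_le f₁.fieldRange_le_normalClosure f₂.fieldRange_le_normalClosure).isDomain'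

/-- Restriction to `A` and `B` is injective because they generate `E`; the orders agree by linear
disjointness. -/
lemma nonempty_mulEquiv_prod_of_sup_eq_top {F E : Type*} [Field F] [Field E] [Algebra F E]
    [FiniteDimensional F E] [IsGalois F E] (A B : IntermediateField F E) [IsGalois F A] [IsGalois F B]
    (hsup : A ⊔ B = ⊤) (hinf : A ⊓ B = ⊥) : Nonempty (Gal(E/F) ≃* Gal(A/F) × Gal(B/F)) := by
  let f : Gal(E/F) →* Gal(A/F) × Gal(B/F) :=
    (AlgEquiv.restrictNormalHom A).prod (AlgEquiv.restrictNormalHom B)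
  have hinj : Function.Injective f := by
    rw [injective_iff_map_eq_one]
    intro σ hσ
    have h1 : σ ∈ (AlgEquiv.restrictNormalHom (F := F) (K₁ := E) A).ker := congrArg Prod.fst hσ
    have h2 : σ ∈ (AlgEquiv.restrictNormalHom (F := F) (K₁ := E) B).ker := congrArg Prod.snd hσ
    rw [IntermediateField.restrictNormalHom_ker] at h1 h2
    have h3 : σ ∈ (A ⊔ B).fixingSubgroup := by
      rw [IntermediateField.fixingSubgroup_sup]
      exact ⟨h1, h2⟩
    rwa [hsup, IntermediateField.fixingSubgroup_top, Subgroup.mem_bot] at h3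
  have hd : A.LinearDisjoint B := LinearDisjoint.of_inf_eq_bot hinf
  have hcard : Nat.card Gal(E/F) = Nat.card (Gal(A/F) × Gal(B/F)) := by
    rw [Nat.card_prod, IsGalois.card_aut_eq_finrank, IsGalois.card_aut_eq_finrank,
      IsGalois.card_aut_eq_finrank, ← hd.finrank_sup, hsup, IntermediateField.finrank_top']
  exact ⟨MulEquiv.ofBijective f ((Nat.bijective_iff_injective_and_card f).2 ⟨hinj, hcard⟩)⟩

lemma nonempty_mulEquiv_prod_of_inf_eq_bot {F E : Type*} [Field F] [Field E] [Algebra F E]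
    (A B : IntermediateField F E) [FiniteDimensional F A] [FiniteDimensional F B] [IsGalois F A]
    [IsGalois F B] (hinf : A ⊓ B = ⊥) :
    Nonempty (Gal((A ⊔ B : IntermediateField F E)/F) ≃* Gal(A/F) × Gal(B/F)) := by
  let A' : IntermediateField F (A ⊔ B : IntermediateField F E) := A.restrict le_sup_left
  let B' : IntermediateField F (A ⊔ B : IntermediateField F E) := B.restrict le_sup_right
  let eA : A ≃ₐ[F] A' := restrictAlgEquiv le_sup_left
  let eB : B ≃ₐ[F] B' := restrictAlgEquiv le_sup_right
  have : IsGalois F A' := IsGalois.of_algEquiv eA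
  have : IsGalois F B' := IsGalois.of_algEquiv eB
  have h₁ : A' ⊔ B' = ⊤ := by
    rw [← lift_inj, lift_top, lift_sup, lift_restrict le_sup_left, lift_restrict le_sup_right]
  have h₂ : A' ⊓ B' = ⊥ := by
    rw [← lift_inj, lift_bot, lift_inf, lift_restrict le_sup_left, lift_restrict le_sup_right, hinf]
  obtain ⟨e⟩ := nonempty_mulEquiv_prod_of_sup_eq_top A' B' h₁ h₂
  exact ⟨e.trans ((AlgEquiv.autCongr eA.symm).prodCongr (AlgEquiv.autCongr eB.symm))⟩

lemma exists_algHom_comp_eq {F K K' E : Type*} [Field F] [Field K] [Field K'] [Field E]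
    [Algebra F K] [Algebra F K'] [Algebra F E] [IsAlgClosed E] [Algebra.IsAlgebraic F K]
    (i : K' →ₐ[F] K) (f : K' →ₐ[F] E) : ∃ g : K →ₐ[F] E, g.comp i = f := by
  let : Algebra K' K := i.toRingHom.toAlgebra
  let : Algebra K' E := f.toRingHom.toAlgebra
  have : IsScalarTower F K' K := IsScalarTower.of_algebraMap_eq fun x => (i.commutes x).symm
  have : IsScalarTower F K' E := IsScalarTower.of_algebraMap_eq fun x => (f.commutes x).symm
  have : Algebra.IsAlgebraic K' K := Algebra.IsAlgebraic.tower_top (K := F) K'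
  let g : K →ₐ[K'] E := IsAlgClosed.lift
  exact ⟨g.restrictScalars F, AlgHom.ext fun x => g.commutes x⟩

/-- Embeddings of `K` restrict to the `Kᵢ`, which generate it; conversely every embedding of `Kᵢ`
extends to `K`. -/
lemma normalClosure_eq_sup {F K K₁ K₂ E : Type*} [Field F] [Field K] [Field K₁] [Field K₂]
    [Field E] [Algebra F K] [Algebra F K₁] [Algebra F K₂] [Algebra F E] [IsAlgClosed E]
    [Algebra.IsAlgebraic F K] (i₁ : K₁ →ₐ[F] K) (i₂ : K₂ →ₐ[F] K)
    (h : i₁.fieldRange ⊔ i₂.fieldRange = ⊤) :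
    normalClosure F K E = normalClosure F K₁ E ⊔ normalClosure F K₂ E := by
  refine le_antisymm ?_ (sup_le ?_ ?_)
  · rw [_root_.normalClosure_le_iff]
    intro f
    rw [AlgHom.fieldRange_eq_map, ← h, IntermediateField.map_sup]
    refine sup_le_sup ?_ ?_
    · rw [AlgHom.map_fieldRange]
      exact (f.comp i₁).fieldRange_le_normalClosure
    · rw [AlgHom.map_fieldRange]
      exact (f.comp i₂).fieldRange_le_normalClosure
  · rw [_root_.normalClosure_le_iff]
    intro f
    obtain ⟨g, rfl⟩ := exists_algHom_comp_eq i₁ f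
    refine le_trans ?_ g.fieldRange_le_normalClosure
    rintro _ ⟨x, rfl⟩
    exact ⟨i₁ x, rfl⟩
  · rw [_root_.normalClosure_le_iff]
    intro f
    obtain ⟨g, rfl⟩ := exists_algHom_comp_eq i₂ f
    refine le_trans ?_ g.fieldRange_le_normalClosure
    rintro _ ⟨x, rfl⟩
    exact ⟨i₂ x, rfl⟩

/-- Needed because the three Galois groups are formed in three different algebraic closures. -/
lemma nonempty_normalClosure_algEquiv (F K E E' : Type*) [Field F] [Field K] [Field E] [Field E']
    [Algebra F K] [Algebra F E] [Algebra F E'] [Algebra.IsAlgebraic F K]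
    [IsAlgClosed E] [IsAlgClosed E'] :
    Nonempty (normalClosure F K E ≃ₐ[F] normalClosure F K E') := by
  have h : IsNormalClosure F K (normalClosure F K E) :=
    Algebra.IsAlgebraic.isNormalClosure_normalClosure fun x => IsAlgClosed.splits _
  have h' : IsNormalClosure F K (normalClosure F K E') :=
    Algebra.IsAlgebraic.isNormalClosure_normalClosure fun x => IsAlgClosed.splits _
  exact ⟨IsNormalClosure.equiv (K := K)⟩

/-- If the normal closures of `K₁` and `K₂` are disjoint then the Galois group of the normal
closure of a compositum is the product of the Galois groups. -/
theorem NormalClosuresDisjoint.nonempty_mulEquiv {F K K₁ K₂ : Type} [Field F] [CharZero F]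
    [Field K] [Field K₁] [Field K₂] [Algebra F K] [Algebra F K₁] [Algebra F K₂]
    [FiniteDimensional F K₁] [FiniteDimensional F K₂]
    (hd : NormalClosuresDisjoint F K₁ K₂) (i₁ : K₁ →ₐ[F] K) (i₂ : K₂ →ₐ[F] K)
    (h : i₁.fieldRange ⊔ i₂.fieldRange = ⊤) :
    Nonempty (Gal(normalClosure F K (AlgebraicClosure K)/F) ≃*
      Gal(normalClosure F K₁ (AlgebraicClosure K₁)/F) ×
        Gal(normalClosure F K₂ (AlgebraicClosure K₂)/F)) := by
  let E := AlgebraicClosure K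
  have hfin : FiniteDimensional F K := by
    have h1 : FiniteDimensional F i₁.fieldRange :=
      Module.Finite.of_surjective i₁.rangeRestrict.toLinearMap i₁.rangeRestrict_surjective
    have h2 : FiniteDimensional F i₂.fieldRange :=
      Module.Finite.of_surjective i₂.rangeRestrict.toLinearMap i₂.rangeRestrict_surjective
    have h3 : FiniteDimensional F (i₁.fieldRange ⊔ i₂.fieldRange : IntermediateField F K) :=
      inferInstance
    rw [h] at h3
    exact Module.Finite.of_surjective (IntermediateField.topEquiv (F := F) (E := K)).toLinearMap
      (IntermediateField.topEquiv (F := F) (E := K)).surjective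
  have : Algebra.IsAlgebraic F E := Algebra.IsAlgebraic.trans F K E
  have := normal_of_isAlgClosed F E
  obtain ⟨e⟩ := nonempty_mulEquiv_prod_of_inf_eq_bot _ _ (hd E)
  rw [← normalClosure_eq_sup i₁ i₂ h] at e
  obtain ⟨e₁⟩ := nonempty_normalClosure_algEquiv F K₁ E (AlgebraicClosure K₁)
  obtain ⟨e₂⟩ := nonempty_normalClosure_algEquiv F K₂ E (AlgebraicClosure K₂)
  exact ⟨e.trans ((AlgEquiv.autCongr e₁).prodCongr (AlgEquiv.autCongr e₂))⟩

end Galois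

end CurveCover
namespace CurveCover

open Polynomial

/-! ### Reduced fibers and separable models -/

section Fiber

open Module

/-- The hypothesis says that `I` and `P` agree locally at `P`. For `z` nilpotent modulo `I` but not
in `I`, it is contradicted at a maximal ideal containing `(I : z)`. -/
lemma isReduced_quotient_of_forall_prime {B : Type*} [CommRing B] (I : Ideal B)
    (h : ∀ P : Ideal B, P.IsPrime → I ≤ P → ∀ z ∈ P, ∃ s ∉ P, s * z ∈ I) :
    _root_.IsReduced (B ⧸ I) := by
  rw [← Ideal.isRadical_iff_quotient_reduced]
  intro z hz
  by_contra hzI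
  let J : Ideal B := I.colon {z}
  have hJ : ∀ s, s ∈ J ↔ s * z ∈ I := fun s => by
    simp only [J, Submodule.mem_colon_singleton, smul_eq_mul]
  have hJ1 : J ≠ ⊤ := by
    rw [Ne, Ideal.eq_top_iff_one, hJ, one_mul]
    exact hzI
  obtain ⟨P, hP, hJP⟩ := J.exists_le_maximal hJ1
  have hIP : I ≤ P := fun x hx => hJP ((hJ x).2 (I.mul_mem_right _ hx))
  have hzP : z ∈ P := (Ideal.IsPrime.radical_le_iff hP.isPrime).2 hIP hz
  obtain ⟨s, hs, hsz⟩ := h P hP.isPrime hIP z hzP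
  exact hs (hJP ((hJ s).2 hsz))

/-- A reduced finite algebra over an algebraically closed field has as many maximal ideals as
its dimension. -/
lemma card_maximalSpectrum_eq_finrank (κ Q : Type*) [Field κ] [IsAlgClosed κ] [CommRing Q]
    [Algebra κ Q] [Module.Finite κ Q] [_root_.IsReduced Q] :
    Nat.card (MaximalSpectrum Q) = finrank κ Q := by
  have : IsArtinianRing Q := IsArtinianRing.of_finite κ Q
  let := Fintype.ofFinite (MaximalSpectrum Q)
  let e : Q ≃ₐ[κ] ∀ I : MaximalSpectrum Q, Q ⧸ I.asIdeal :=
    (IsArtinianRing.equivPi Q).restrictScalars κ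
  have h1 : ∀ I : MaximalSpectrum Q, finrank κ (Q ⧸ I.asIdeal) = 1 := fun I => by
    have := I.isMaximal
    let := Ideal.Quotient.field I.asIdeal
    rw [← Module.finrank_self κ]
    exact (LinearEquiv.ofBijective (Algebra.linearMap κ (Q ⧸ I.asIdeal))
      (IsAlgClosed.algebraMap_bijective_of_isIntegral (k := κ))).finrank_eq.symm
  rw [e.toLinearEquiv.finrank_eq, Module.finrank_pi_fintype, Finset.sum_congr rfl fun I _ => h1 I]
  simp

/-- Chinese remainder theorem: some function takes distinct values at the finitely many points. -/
lemma exists_forall_sub_mem_maximalIdeal (κ Q : Type*) [Field κ] [IsAlgClosed κ] [CommRing Q]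
    [Algebra κ Q] [Module.Finite κ Q] [_root_.IsReduced Q] :
    ∃ (q : Q) (ε : MaximalSpectrum Q → κ), Function.Injective ε ∧
      ∀ I : MaximalSpectrum Q, q - algebraMap κ Q (ε I) ∈ I.asIdeal := by
  have : IsArtinianRing Q := IsArtinianRing.of_finite κ Q
  have : Infinite κ := IsAlgClosed.instInfinite
  obtain ⟨ε⟩ : Nonempty (MaximalSpectrum Q ↪ κ) :=
    ⟨(Finite.equivFin _).toEmbedding.trans (Fin.valEmbedding.trans (Infinite.natEmbedding κ))⟩
  obtain ⟨q, hq⟩ := (IsArtinianRing.equivPi Q).surjective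
    fun I => Ideal.Quotient.mk I.asIdeal (algebraMap κ Q (ε I))
  exact ⟨q, ε, ε.injective, fun I => Ideal.Quotient.eq.1 (congrFun hq I)⟩

/-- `B` is free over `k[X]` of rank `n = [K : F]`, and its fiber at `a` is reduced, so it consists
of `n` points. Let `f` separate them. Its minimal polynomial has degree at most `n`, while the
reduction at `a` has the `n` values of `f` as roots; so the degree is `n`, `f` generates `K`, and
the reduction is separable. -/
lemma hasSeparableModel_of_forall_prime {k : Type*} [Field k] [IsAlgClosed k] [CharZero k]
    {F K B : Type*} [Field F] [Field K] [CommRing B] [IsDomain B] [Algebra k[X] F]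
    [IsFractionRing k[X] F] [Algebra k[X] B] [Module.Finite k[X] B] [Algebra B K]
    [IsFractionRing B K] [Algebra F K] [Algebra k[X] K] [IsScalarTower k[X] F K]
    [IsScalarTower k[X] B K] [FiniteDimensional F K] (a : k)
    (h : ∀ P : Ideal B, P.IsPrime → algebraMap k[X] B (X - C a) ∈ P → ∀ z ∈ P, ∃ s ∉ P,
      s * z ∈ Ideal.span {algebraMap k[X] B (X - C a)}) :
    HasSeparableModel (algebraMap k[X] F) a K := by
  classical
  have hinjK : Function.Injective (algebraMap k[X] K) := by
    rw [IsScalarTower.algebraMap_eq k[X] F K]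
    exact (algebraMap F K).injective.comp (IsFractionRing.injective k[X] F)
  have hinjB : Function.Injective (algebraMap k[X] B) := by
    rw [IsScalarTower.algebraMap_eq k[X] B K] at hinjK
    exact Function.Injective.of_comp (f := algebraMap B K) hinjK
  have : FaithfulSMul k[X] B := (faithfulSMul_iff_algebraMap_injective k[X] B).2 hinjB
  have : Module.IsTorsionFree k[X] B := inferInstance
  have : Module.Free k[X] B := inferInstance
  have : CharZero F := charZero_of_injective_algebraMap (IsFractionRing.injective k[X] F)
  let p : Ideal k[X] := Ideal.span {X - C a}
  have hp : p.IsMaximal := PrincipalIdealRing.isMaximal_of_irreducible (irreducible_X_sub_C a)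
  let := Ideal.Quotient.field p
  let e : (k[X] ⧸ p) ≃+* k := (quotientSpanXSubCAlgEquiv a).toRingEquiv
  have : IsAlgClosed (k[X] ⧸ p) := IsAlgClosed.of_ringEquiv k _ e.symm
  let I : Ideal B := p.map (algebraMap k[X] B)
  have hI : I = Ideal.span {algebraMap k[X] B (X - C a)} := by
    simp only [I, p, Ideal.map_span, Set.image_singleton]
  have : _root_.IsReduced (B ⧸ I) := isReduced_quotient_of_forall_prime I fun P hP hIP z hz => by
    rw [hI] at hIP ⊢
    exact h P hP (hIP (Ideal.mem_span_singleton_self _)) z hz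
  have hfr : Module.Finite (k[X] ⧸ p) (B ⧸ I) := Module.Finite.of_restrictScalars_finite k[X] _ _
  have hrank : finrank (k[X] ⧸ p) (B ⧸ I) = finrank F K := by
    rw [(Algebra.TensorProduct.quotIdealMapEquivQuotTensor B p).toLinearEquiv.finrank_eq,
      Module.finrank_baseChange]
    exact (IsFractionRing.finrank_eq k[X] F B K).symm
  obtain ⟨q, ε, hε, hq⟩ := exists_forall_sub_mem_maximalIdeal (k[X] ⧸ p) (B ⧸ I)
  obtain ⟨f, rfl⟩ := Ideal.Quotient.mk_surjective q
  have hfint : IsIntegral k[X] f := Algebra.IsIntegral.isIntegral f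
  have hfint' : IsIntegral k[X] (algebraMap B K f) := hfint.map (IsScalarTower.toAlgHom k[X] B K)
  let m := minpoly k[X] (algebraMap B K f)
  have hm : m.Monic := minpoly.monic hfint'
  have hmf : aeval f m = 0 := by
    apply IsFractionRing.injective B K
    rw [← aeval_algebraMap_apply, minpoly.aeval, map_zero]
  have hdeg : (minpoly F (algebraMap B K f)).natDegree = m.natDegree := by
    rw [minpoly.isIntegrallyClosed_eq_field_fractions' F hfint', hm.natDegree_map]
  have hle : m.natDegree ≤ finrank F K := hdeg ▸ minpoly.natDegree_le _
  have hroots : ∀ J, (m.map (Ideal.Quotient.mk p)).IsRoot (ε J) := fun J => by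
    have h1 : aeval (Ideal.Quotient.mk I f) (m.map (Ideal.Quotient.mk p)) = 0 := by
      have : Ideal.Quotient.mk I (aeval f m) = aeval (Ideal.Quotient.mk I f) m :=
        (aeval_algebraMap_apply (B ⧸ I) f m).symm
      rw [hmf, map_zero] at this
      rw [this]
      exact aeval_map_algebraMap (k[X] ⧸ p) (Ideal.Quotient.mk I f) m
    have h2 : algebraMap _ (B ⧸ I) ((m.map (Ideal.Quotient.mk p)).eval (ε J)) ∈ J.asIdeal := by
      have h3 := sub_dvd_eval_sub (Ideal.Quotient.mk I f) (algebraMap _ (B ⧸ I) (ε J))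
        ((m.map (Ideal.Quotient.mk p)).map (algebraMap _ (B ⧸ I)))
      rw [eval_map_algebraMap, h1, eval_map_algebraMap, aeval_algebraMap_apply, zero_sub,
        dvd_neg] at h3
      exact J.asIdeal.mem_of_dvd h3 (hq J)
    by_contra h4
    exact J.isMaximal.ne_top (Ideal.eq_top_of_isUnit_mem _ h2
      ((isUnit_iff_ne_zero.2 h4).map _))
  have : IsArtinianRing (B ⧸ I) := IsArtinianRing.of_finite (k[X] ⧸ p) _
  let := Fintype.ofFinite (MaximalSpectrum (B ⧸ I))
  have hcard : Fintype.card (MaximalSpectrum (B ⧸ I)) = finrank F K := by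
    rw [← Nat.card_eq_fintype_card, card_maximalSpectrum_eq_finrank (k[X] ⧸ p), hrank]
  have hmp : (m.map (Ideal.Quotient.mk p)).Monic := hm.map _
  have hsub : (Finset.univ.image ε) ⊆ (m.map (Ideal.Quotient.mk p)).roots.toFinset := by
    intro x hx
    obtain ⟨J, -, rfl⟩ := Finset.mem_image.1 hx
    exact Multiset.mem_toFinset.2 ((mem_roots hmp.ne_zero).2 (hroots J))
  have hge : finrank F K ≤ (m.map (Ideal.Quotient.mk p)).roots.toFinset.card := by
    rw [← hcard, ← Finset.card_univ, ← Finset.card_image_of_injective _ hε]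
    exact Finset.card_le_card hsub
  have hr1 := Multiset.toFinset_card_le (m.map (Ideal.Quotient.mk p)).roots
  have hr2 := card_roots' (m.map (Ideal.Quotient.mk p))
  rw [hm.natDegree_map] at hr2
  have hnodup : (m.map (Ideal.Quotient.mk p)).roots.Nodup :=
    Multiset.toFinset_card_eq_card_iff_nodup.1 (by omega)
  have hsep : (m.map (Ideal.Quotient.mk p)).Separable :=
    (nodup_roots_iff_of_splits hmp.ne_zero (IsAlgClosed.splits _)).1 hnodup
  refine ⟨algebraMap B K f, m, hm, ?_, ?_, ?_⟩
  · rw [← IsScalarTower.algebraMap_eq]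
    exact minpoly.aeval k[X] (algebraMap B K f)
  · have he : (e : k[X] ⧸ p →+* k).comp (Ideal.Quotient.mk p) = evalRingHom a := by
      ext x <;> simp [e, p]
    rw [← he, ← Polynomial.map_map]
    exact hsep.map
  · rw [Field.primitive_element_iff_minpoly_natDegree_eq, hdeg]
    omega

end Fiber

end CurveCover
namespace CurveCover

open Polynomial

/-! ### Coordinates on the standard charts of the projective line -/

section AwayCoordinate

open HomogeneousLocalization

local notation "𝒜" => MvPolynomial.homogeneousSubmodule (Fin (1 + 1)) ℂ

lemma X_mem_homogeneousSubmodule (i : Fin (1 + 1)) :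
    (MvPolynomial.X i : MvPolynomial (Fin (1 + 1)) ℂ) ∈ 𝒜 1 :=
  (MvPolynomial.mem_homogeneousSubmodule _ _).2 (MvPolynomial.isHomogeneous_X ℂ i)

/-- The coordinate `xⱼ / xᵢ` on the chart `xᵢ ≠ 0` of the projective line. -/
noncomputable def awayCoord (i j : Fin (1 + 1)) : Away 𝒜 (MvPolynomial.X i) :=
  Away.mk 𝒜 (X_mem_homogeneousSubmodule i) 1 (MvPolynomial.X j)
    (by simpa using X_mem_homogeneousSubmodule j)

/-- The constants among the regular functions on a standard chart of the projective line. -/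
noncomputable def awayConst (f : MvPolynomial (Fin (1 + 1)) ℂ) : ℂ →+* Away 𝒜 f :=
  (fromZeroRingHom 𝒜 _).comp (algebraMap ℂ (𝒜 0))

/-- The map `ℂ[T] → ℂ[x₀, x₁]_{(xᵢ)}` sending `T` to `xⱼ / xᵢ`. -/
noncomputable def polynomialToAway (i j : Fin (1 + 1)) : ℂ[X] →+* Away 𝒜 (MvPolynomial.X i) :=
  eval₂RingHom (awayConst _) (awayCoord i j)

lemma val_awayConst (f : MvPolynomial (Fin (1 + 1)) ℂ) (c : ℂ) :
    (awayConst f c).val = algebraMap _ _ (MvPolynomial.C c : MvPolynomial (Fin (1 + 1)) ℂ) := by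
  rw [← Localization.mk_one_eq_algebraMap]
  rfl

lemma val_awayCoord_mul (i j : Fin (1 + 1)) :
    (awayCoord i j).val * algebraMap _ _ (MvPolynomial.X i : MvPolynomial (Fin (1 + 1)) ℂ) =
      algebraMap _ _ (MvPolynomial.X j : MvPolynomial (Fin (1 + 1)) ℂ) := by
  rw [awayCoord, Away.val_mk, Localization.mk_eq_mk', mul_comm]
  have := IsLocalization.mk'_spec'
    (Localization.Away (MvPolynomial.X i : MvPolynomial (Fin (1 + 1)) ℂ))
    (MvPolynomial.X j : MvPolynomial (Fin (1 + 1)) ℂ)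
    (⟨MvPolynomial.X i ^ 1, 1, rfl⟩ : Submonoid.powers (MvPolynomial.X i))
  simpa only [pow_one] using this

/-- Dehomogenizing, by `xᵢ ↦ 1` and `xⱼ ↦ T`, gives a left inverse. -/
lemma polynomialToAway_injective {i j : Fin (1 + 1)} (hij : i ≠ j) :
    Function.Injective (polynomialToAway i j) := by
  let ev : MvPolynomial (Fin (1 + 1)) ℂ →+* ℂ[X] :=
    (MvPolynomial.aeval fun l => if l = i then (1 : ℂ[X]) else X).toRingHom
  have hev : IsUnit (ev (MvPolynomial.X i)) := by simp [ev]
  let l : Localization.Away (MvPolynomial.X i : MvPolynomial (Fin (1 + 1)) ℂ) →+* ℂ[X] :=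
    IsLocalization.Away.lift (MvPolynomial.X i) hev
  have hl : ∀ p, l (algebraMap _ _ p) = ev p := fun p => IsLocalization.Away.lift_eq _ hev p
  have h : (l.comp (algebraMap (Away 𝒜 (MvPolynomial.X i)) _)).comp (polynomialToAway i j) =
      RingHom.id _ := by
    apply Polynomial.ringHom_ext
    · intro c
      simp [polynomialToAway, HomogeneousLocalization.algebraMap_apply, val_awayConst, hl, ev]
    · have h1 := congrArg l (val_awayCoord_mul i j)
      rw [map_mul, hl, hl] at h1
      simpa [polynomialToAway, HomogeneousLocalization.algebraMap_apply, ev, hij.symm] using h1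
  exact Function.HasLeftInverse.injective
    ⟨l.comp (algebraMap (Away 𝒜 (MvPolynomial.X i)) _), fun q => RingHom.congr_fun h q⟩

lemma polynomialToAway_surjective {i j : Fin (1 + 1)} (hij : i ≠ j) :
    Function.Surjective (polynomialToAway i j) := by
  intro z
  obtain ⟨n, p, hp, rfl⟩ := Away.mk_surjective 𝒜 (X_mem_homogeneousSubmodule i) z
  rw [smul_eq_mul, mul_one] at hp
  let S := RingHom.rangeS ((algebraMap (Away 𝒜 (MvPolynomial.X i))
    (Localization.Away (MvPolynomial.X i : MvPolynomial (Fin (1 + 1)) ℂ))).comp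
      (polynomialToAway i j))
  suffices h : (Away.mk 𝒜 (X_mem_homogeneousSubmodule i) n p (by simpa using hp)).val ∈ S by
    obtain ⟨q, hq⟩ := h
    exact ⟨q, val_injective _ hq⟩
  rw [Away.val_mk, Localization.mk_eq_mk', ← mul_one p, ← IsLocalization.smul_mk',
    Algebra.smul_def, p.as_sum, map_sum, Finset.sum_mul]
  refine sum_mem fun d hd => ⟨C (p.coeff d) * X ^ d j, ?_⟩
  have hdn : d i + d j = n := by
    have := ((MvPolynomial.mem_homogeneousSubmodule _ _).1 hp).degree_eq_sum_deg_support hd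
    rw [this, ← Finsupp.degree_apply, Finsupp.degree_eq_sum]
    fin_cases i <;> fin_cases j <;> simp_all [Fin.sum_univ_two, add_comm]
  have hmon : MvPolynomial.monomial d (p.coeff d) =
      MvPolynomial.C (p.coeff d) * MvPolynomial.X i ^ d i * MvPolynomial.X j ^ d j := by
    rw [MvPolynomial.monomial_eq, Finsupp.prod_fintype _ _ (by simp), mul_assoc]
    fin_cases i <;> fin_cases j <;> simp_all [mul_comm]
  rw [← IsLocalization.mk'_one (M := Submonoid.powers (MvPolynomial.X i : MvPolynomial (Fin (1 + 1)) ℂ)), ← IsLocalization.mk'_mul, IsLocalization.eq_mk'_iff_mul_eq]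
  simp only [polynomialToAway, HomogeneousLocalization.algebraMap_apply, val_awayConst, hmon, map_mul, map_pow,
    RingHom.comp_apply, coe_eval₂RingHom, eval₂_C, eval₂_X, ← val_awayCoord_mul i j, ← hdn,
    one_mul, mul_one]
  ring

/-- The isomorphism `ℂ[T] ≃ ℂ[x₀, x₁]_{(xᵢ)}` sending `T` to `xⱼ / xᵢ`. -/
noncomputable def polynomialEquivAway {i j : Fin (1 + 1)} (hij : i ≠ j) :
    ℂ[X] ≃+* Away 𝒜 (MvPolynomial.X i) :=
  RingEquiv.ofBijective (polynomialToAway i j)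
    ⟨polynomialToAway_injective hij, polynomialToAway_surjective hij⟩

/-- The standard chart `xᵢ ≠ 0` of the projective line. -/
noncomputable def lineChart (i : Fin (1 + 1)) : (ProjSpace 1).Opens :=
  Proj.basicOpen 𝒜 (MvPolynomial.X i)

lemma isAffineOpen_lineChart (i : Fin (1 + 1)) : IsAffineOpen (lineChart i) :=
  Proj.isAffineOpen_basicOpen 𝒜 _ (X_mem_homogeneousSubmodule i) one_pos

lemma iSup_lineChart : ⨆ i, lineChart i = ⊤ := by
  apply Proj.iSup_basicOpen_eq_top' 𝒜 _ fun i => ⟨1, X_mem_homogeneousSubmodule i⟩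
  rw [eq_top_iff]
  rintro p -
  induction p using MvPolynomial.induction_on with
  | C a => exact Subalgebra.algebraMap_mem _ (algebraMap ℂ (𝒜 0) a)
  | add p q hp hq => exact add_mem hp hq
  | mul_X p i hp => exact mul_mem hp (Algebra.subset_adjoin ⟨i, rfl⟩)

/-- The coordinate ring of a standard chart of the projective line is a polynomial ring. -/
noncomputable def lineChartEquiv {i j : Fin (1 + 1)} (hij : i ≠ j) :
    ℂ[X] ≃+* Γ(ProjSpace 1, lineChart i) :=
  (polynomialEquivAway hij).trans
    (Proj.basicOpenIsoAway 𝒜 _ (X_mem_homogeneousSubmodule i) one_pos).commRingCatIsoToRingEquiv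

instance nonempty_lineChart (i : Fin (1 + 1)) : Nonempty (lineChart i) := by
  obtain ⟨j, hij⟩ := exists_ne i
  have : Nontrivial Γ(ProjSpace 1, lineChart i) := (lineChartEquiv hij.symm).symm.toEquiv.nontrivial
  by_contra h
  have h0 : lineChart i = ⊥ := by
    ext x
    simpa using fun hx => h ⟨⟨x, hx⟩⟩
  rw [h0] at this
  have : Subsingleton Γ(ProjSpace 1, ⊥) := inferInstance
  exact not_subsingleton Γ(ProjSpace 1, ⊥) this

/-- The inclusion of the coordinate ring of a standard chart into the function field of the
projective line. -/
noncomputable def lineChartMap {i j : Fin (1 + 1)} (hij : i ≠ j) :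
    ℂ[X] →+* (ProjSpace 1).functionField :=
  ((ProjSpace 1).germToFunctionField (lineChart i)).hom.comp (lineChartEquiv hij).toRingHom

lemma germToFunctionField_awayToSection {f g x : MvPolynomial (Fin (1 + 1)) ℂ} {m : ℕ}
    (hg : g ∈ 𝒜 m) (hx : x = f * g)
    (hf : genericPoint (ProjSpace 1) ∈ Proj.basicOpen 𝒜 f)
    (hx' : genericPoint (ProjSpace 1) ∈ Proj.basicOpen 𝒜 x) (z : Away 𝒜 f) :
    ((ProjSpace 1).presheaf.germ _ _ hf).hom ((Proj.awayToSection 𝒜 f).hom z) =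
      ((ProjSpace 1).presheaf.germ _ _ hx').hom
        ((Proj.awayToSection 𝒜 x).hom (awayMap 𝒜 hg hx z)) := by
  have h := congrArg (fun φ => φ.hom z) (Proj.awayMap_awayToSection 𝒜 hg hx)
  simp only [CommRingCat.hom_comp, RingHom.comp_apply, CommRingCat.hom_ofHom] at h
  rw [h]
  exact (((ProjSpace 1).presheaf.germ_res_apply _ _ hx' _)).symm

/-- Both chart maps factor through the overlap of the charts, so identities between them can be
checked in the localization at `xᵢ xⱼ`. -/
lemma exists_germ_lineChart (i j : Fin (1 + 1)) (hij : i ≠ j) :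
    ∃ φ : Away 𝒜 (MvPolynomial.X i * MvPolynomial.X j) →+* (ProjSpace 1).functionField,
      lineChartMap hij = φ.comp ((awayMap 𝒜 (X_mem_homogeneousSubmodule j) rfl).comp
        (polynomialToAway i j)) ∧
      lineChartMap hij.symm = φ.comp ((awayMap 𝒜 (X_mem_homogeneousSubmodule i)
        (mul_comm _ _)).comp (polynomialToAway j i)) := by
  have hg : ∀ i : Fin (1 + 1), genericPoint (ProjSpace 1) ∈ lineChart i := fun i =>
    ((genericPoint_spec (ProjSpace 1)).mem_open_set_iff (lineChart i).isOpen).mpr (by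
      simpa using nonempty_lineChart i)
  have hx : genericPoint (ProjSpace 1) ∈
      Proj.basicOpen 𝒜 (MvPolynomial.X i * MvPolynomial.X j) := by
    rw [Proj.basicOpen_mul]
    exact ⟨hg i, hg j⟩
  refine ⟨((ProjSpace 1).presheaf.germ _ _ hx).hom.comp
    (Proj.awayToSection 𝒜 (MvPolynomial.X i * MvPolynomial.X j)).hom, ?_, ?_⟩
  · refine RingHom.ext fun p => ?_
    exact germToFunctionField_awayToSection (X_mem_homogeneousSubmodule j) rfl (hg i) hx (polynomialToAway i j p)
  · refine RingHom.ext fun p => ?_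
    exact germToFunctionField_awayToSection (X_mem_homogeneousSubmodule i) (mul_comm _ _) (hg j) hx (polynomialToAway j i p)

lemma lineChartMap_C {i j : Fin (1 + 1)} (hij : i ≠ j) (c : ℂ) :
    lineChartMap hij.symm (C c) = lineChartMap hij (C c) := by
  obtain ⟨φ, h1, h2⟩ := exists_germ_lineChart i j hij
  rw [h1, h2]
  simp only [RingHom.comp_apply]
  congr 1
  apply val_injective
  simp only [val_awayMap, polynomialToAway, coe_eval₂RingHom, eval₂_C, val_awayConst]
  simp [Localization.awayLift]

lemma lineChartMap_X_mul {i j : Fin (1 + 1)} (hij : i ≠ j) :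
    lineChartMap hij X * lineChartMap hij.symm X = 1 := by
  obtain ⟨φ, h1, h2⟩ := exists_germ_lineChart i j hij
  rw [h1, h2]
  simp only [RingHom.comp_apply, ← map_mul]
  convert map_one φ
  apply val_injective
  have h3 := congrArg (Localization.awayLift (algebraMap _
    (Localization.Away (MvPolynomial.X i * MvPolynomial.X j : MvPolynomial (Fin (1 + 1)) ℂ))) _
      (isUnit_of_dvd_unit (map_dvd _ (dvd_mul_right (MvPolynomial.X i) (MvPolynomial.X j)))
        (IsLocalization.Away.algebraMap_isUnit _))) (val_awayCoord_mul i j)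
  have h4 := congrArg (Localization.awayLift (algebraMap _
    (Localization.Away (MvPolynomial.X i * MvPolynomial.X j : MvPolynomial (Fin (1 + 1)) ℂ))) _
      (isUnit_of_dvd_unit (map_dvd _ (dvd_mul_left (MvPolynomial.X j) (MvPolynomial.X i)))
        (IsLocalization.Away.algebraMap_isUnit _))) (val_awayCoord_mul j i)
  simp only [map_mul, Localization.awayLift, IsLocalization.Away.lift_eq] at h3 h4
  have hu : IsUnit (algebraMap (MvPolynomial (Fin (1 + 1)) ℂ)
      (Localization.Away (MvPolynomial.X i * MvPolynomial.X j : MvPolynomial (Fin (1 + 1)) ℂ))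
      (MvPolynomial.X i * MvPolynomial.X j)) := IsLocalization.Away.algebraMap_isUnit _
  refine hu.mul_right_cancel ?_
  simp only [val_mul, val_awayMap, polynomialToAway, coe_eval₂RingHom, eval₂_X, val_one, map_mul,
    Localization.awayLift]
  rw [one_mul, mul_mul_mul_comm, h3, h4]
  exact mul_comm _ _

end AwayCoordinate

end CurveCover
namespace CurveCover

open Polynomial

/-! ### Closed points in a coordinate chart -/

section LineChartPoints

lemma jacobsonSpace_projSpace_one : JacobsonSpace (ProjSpace 1) := by
  have hc : TopologicalSpace.IsOpenCover lineChart := iSup_lineChart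
  rw [hc.jacobsonSpace_iff]
  intro i
  obtain ⟨j, hij⟩ := exists_ne i
  have : IsJacobsonRing Γ(ProjSpace 1, lineChart i) :=
    isJacobsonRing_of_surjective ⟨(lineChartEquiv hij.symm).toRingHom,
      (lineChartEquiv hij.symm).surjective⟩
  exact JacobsonSpace.of_isOpenEmbedding
    (isAffineOpen_lineChart i).isoSpec.hom.homeomorph.isOpenEmbedding

/-- The point of an affine open subset `U` at which the coordinate `e : k[X] ≃ Γ(Y, U)` takes
the value `a`. -/
noncomputable def coordPoint {k : Type} [Field k] {Y : Scheme.{0}} {U : Y.Opens}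
    (hU : IsAffineOpen U) (e : k[X] ≃+* Γ(Y, U)) (a : k) : Y :=
  hU.fromSpec ⟨(Ideal.span {X - C a}).map e, by
    have : (Ideal.span {X - C a}).IsPrime :=
      (Ideal.span_singleton_prime (X_sub_C_ne_zero a)).2 (prime_X_sub_C a)
    exact Ideal.map_isPrime_of_equiv e⟩

variable {k : Type} [Field k] {Y : Scheme.{0}} {U : Y.Opens} (hU : IsAffineOpen U)
  (e : k[X] ≃+* Γ(Y, U)) (a : k)

lemma coordPoint_mem : coordPoint hU e a ∈ U := by
  rw [← SetLike.mem_coe, ← hU.range_fromSpec]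
  exact ⟨_, rfl⟩

lemma fromSpec_injective : Function.Injective hU.fromSpec :=
  hU.fromSpec.isOpenEmbedding.injective

lemma primeIdealOf_coordPoint :
    (hU.primeIdealOf ⟨coordPoint hU e a, coordPoint_mem hU e a⟩).asIdeal =
      Ideal.span {e (X - C a)} := by
  have h := hU.fromSpec_primeIdealOf ⟨coordPoint hU e a, coordPoint_mem hU e a⟩
  rw [fromSpec_injective hU h]
  exact (Ideal.map_span _ _).trans (by rw [Set.image_singleton])

lemma isMaximal_span_coord : (Ideal.span {e (X - C a)}).IsMaximal := by
  have : (Ideal.span {X - C a}).IsMaximal :=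
    PrincipalIdealRing.isMaximal_of_irreducible (irreducible_X_sub_C a)
  have h := Ideal.map_isMaximal_of_equiv e (p := Ideal.span {X - C a})
  rwa [Ideal.map_span, Set.image_singleton] at h

/-- In a Jacobson space a point closed in an open subset is closed in the whole space; the branch
locus contains only closed points. -/
lemma isClosed_coordPoint [JacobsonSpace Y] : IsClosed {coordPoint hU e a} := by
  rw [← mem_closedPoints_iff]
  let P := hU.primeIdealOf ⟨coordPoint hU e a, coordPoint_mem hU e a⟩
  have hP : hU.fromSpec P = coordPoint hU e a :=
    hU.fromSpec_primeIdealOf ⟨coordPoint hU e a, coordPoint_mem hU e a⟩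
  rw [← hP]
  have hPc : IsClosed {P} := by
    rw [PrimeSpectrum.isClosed_singleton_iff_isMaximal, primeIdealOf_coordPoint]
    exact isMaximal_span_coord e a
  have h := hU.fromSpec.isOpenEmbedding.preimage_closedPoints
  exact h.ge hPc

lemma isUnit_germ_iff (y : Y) (hy : y ∈ U) (s : Γ(Y, U)) :
    IsUnit (Y.presheaf.germ U y hy s) ↔ s ∉ (hU.primeIdealOf ⟨y, hy⟩).asIdeal := by
  let := Y.presheaf.algebra_section_stalk ⟨y, hy⟩
  have := hU.isLocalization_stalk ⟨y, hy⟩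
  exact IsLocalization.AtPrime.isUnit_to_map_iff (Y.presheaf.stalk y)
    (hU.primeIdealOf ⟨y, hy⟩).asIdeal s

variable {a} in
lemma isUnit_germ_coordPoint_iff {y : Y} (hy : y ∈ U) (h : y = coordPoint hU e a) (p : k[X]) :
    IsUnit (Y.presheaf.germ U y hy (e p)) ↔ p.eval a ≠ 0 := by
  subst h
  rw [isUnit_germ_iff hU, primeIdealOf_coordPoint, Ideal.mem_span_singleton, map_dvd_iff,
    dvd_iff_isRoot, IsRoot.def]

lemma coordPoint_injective : Function.Injective (coordPoint hU e) := by
  intro a b h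
  have h1 := isUnit_germ_coordPoint_iff hU e (coordPoint_mem hU e a) rfl (X - C a)
  have h2 := isUnit_germ_coordPoint_iff hU e (coordPoint_mem hU e a) h (X - C a)
  simpa [sub_eq_zero, eq_comm] using h1.symm.trans h2

lemma eq_coordPoint_of_mem (y : Y) (hy : y ∈ U)
    (h : e (X - C a) ∈ (hU.primeIdealOf ⟨y, hy⟩).asIdeal) : y = coordPoint hU e a := by
  have h1 : (hU.primeIdealOf ⟨y, hy⟩).asIdeal =
      (hU.primeIdealOf ⟨coordPoint hU e a, coordPoint_mem hU e a⟩).asIdeal := by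
    rw [primeIdealOf_coordPoint]
    refine ((isMaximal_span_coord e a).eq_of_le (hU.primeIdealOf ⟨y, hy⟩).isPrime.ne_top ?_).symm
    rwa [Ideal.span_singleton_le_iff_mem]
  have h2 := hU.fromSpec_primeIdealOf ⟨y, hy⟩
  rw [PrimeSpectrum.ext h1, hU.fromSpec_primeIdealOf] at h2
  exact h2.symm

end LineChartPoints

/-! ### Function fields and separable models at unbranched points -/

section FunctionField

variable {X Y : Scheme.{0}} [IsIntegral X] [IsIntegral Y] (f : X ⟶ Y) [IsDominant f]

lemma genericPoint_mem {X : Scheme.{0}} [IsIntegral X] (U : X.Opens) [h : Nonempty U] :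
    genericPoint X ∈ U :=
  ((genericPoint_spec X).mem_open_set_iff U.isOpen).mpr (by simpa using h)

instance nonempty_preimage (U : Y.Opens) [Nonempty U] : Nonempty (f ⁻¹ᵁ U : X.Opens) :=
  ⟨⟨genericPoint X, by
    change f (genericPoint X) ∈ U
    rw [map_genericPoint f]
    exact genericPoint_mem U⟩⟩

lemma functionFieldMap_germToFunctionField (U : Y.Opens) [Nonempty U] (s : Γ(Y, U)) :
    functionFieldMap f ((Y.germToFunctionField U).hom s) =
      (X.germToFunctionField (f ⁻¹ᵁ U)).hom ((f.app U).hom s) := by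
  have hx : f (genericPoint X) ∈ U := by
    rw [map_genericPoint f]
    exact genericPoint_mem U
  have h := Y.presheaf.germ_stalkSpecializes_apply (genericPoint_mem U)
    (specializes_of_eq (map_genericPoint f)) s
  simp only [functionFieldMap, CommRingCat.hom_comp, RingHom.comp_apply]
  erw [h]
  exact f.germ_stalkMap_apply U (genericPoint X) hx s

end FunctionField

section Unramified

variable {X Y : Scheme.{0}} {f : X ⟶ Y}

/-- The point of `P` lies over `a`, and being unramified there means that `X - a` generates the
maximal ideal of the local ring at `P`; `s` clears the denominator. -/
lemma exists_mul_mem_span_of_not_isRamifiedAt {k : Type} [Field k] {U : Y.Opens}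
    (hU : IsAffineOpen U) (e : k[X] ≃+* Γ(Y, U)) (a : k) (hV : IsAffineOpen (f ⁻¹ᵁ U))
    (h : ∀ x, f x = coordPoint hU e a → ¬IsRamifiedAt f x) (P : Ideal Γ(X, f ⁻¹ᵁ U)) (hP : P.IsPrime)
    (hPa : (f.app U).hom (e (Polynomial.X - C a)) ∈ P) {z : Γ(X, f ⁻¹ᵁ U)} (hz : z ∈ P) :
    ∃ s ∉ P, s * z ∈ Ideal.span {(f.app U).hom (e (Polynomial.X - C a))} := by
  let x : X := hV.fromSpec ⟨P, hP⟩
  have hx : x ∈ f ⁻¹ᵁ U := by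
    rw [← SetLike.mem_coe, ← hV.range_fromSpec]
    exact ⟨_, rfl⟩
  have hxP : hV.primeIdealOf ⟨x, hx⟩ = ⟨P, hP⟩ :=
    fromSpec_injective hV (hV.fromSpec_primeIdealOf ⟨x, hx⟩)
  have hfx : f x = coordPoint hU e a := by
    refine eq_coordPoint_of_mem hU e a (f x) hx ?_
    by_contra h1
    rw [← isUnit_germ_iff hU (f x) hx] at h1
    have h2 := h1.map (f.stalkMap x).hom
    erw [f.germ_stalkMap_apply U x hx] at h2
    rw [isUnit_germ_iff hV, hxP] at h2
    exact h2 hPa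
  have hmax := not_not.1 (h x hfx)
  let := Y.presheaf.algebra_section_stalk ⟨f x, hx⟩
  have hloc := hU.isLocalization_stalk ⟨f x, hx⟩
  let := X.presheaf.algebra_section_stalk ⟨x, hx⟩
  have hloc' := hV.isLocalization_stalk ⟨x, hx⟩
  rw [hxP] at hloc'
  have hPy : (hU.primeIdealOf ⟨f x, hx⟩).asIdeal = Ideal.span {e (Polynomial.X - C a)} := by
    rw [← primeIdealOf_coordPoint hU e a]
    congr 3
  have hmy := IsLocalization.AtPrime.map_eq_maximalIdeal (hU.primeIdealOf ⟨f x, hx⟩).asIdeal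
    (Y.presheaf.stalk (f x))
  have hmx := IsLocalization.AtPrime.map_eq_maximalIdeal P (X.presheaf.stalk x)
  have hzx : algebraMap _ (X.presheaf.stalk x) z ∈ Ideal.span
      {algebraMap _ (X.presheaf.stalk x) ((f.app U).hom (e (Polynomial.X - C a)))} := by
    have h3 : algebraMap _ (X.presheaf.stalk x) z ∈
        IsLocalRing.maximalIdeal (X.presheaf.stalk x) := hmx ▸ Ideal.mem_map_of_mem _ hz
    rw [← hmax, ← hmy, hPy, Ideal.map_span, Ideal.map_span, Set.image_singleton,
      Set.image_singleton] at h3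
    convert h3 using 3
    exact (f.germ_stalkMap_apply U x hx _).symm
  rw [← Set.image_singleton, ← Ideal.map_span,
    IsLocalization.algebraMap_mem_map_algebraMap_iff P.primeCompl] at hzx
  obtain ⟨s, hs, hsz⟩ := hzx
  exact ⟨s, hs, hsz⟩

end Unramified

section Model

variable {X Y : Scheme.{0}} [IsIntegral X] [IsIntegral Y] (f : X ⟶ Y) [IsDominant f] [IsFinite f]

omit [IsIntegral X] [IsDominant f] [IsFinite f] in
lemma isFractionRing_coord {k : Type} [Field k] {U : Y.Opens} [Nonempty U] (hU : IsAffineOpen U)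
    (e : k[X] ≃+* Γ(Y, U)) :
    @IsFractionRing k[X] _ Y.functionField _
      ((Y.germToFunctionField U).hom.comp e.toRingHom).toAlgebra :=
  have := functionField_isFractionRing_of_isAffineOpen Y U hU
  (IsFractionRing.isFractionRing_iff_of_base_ringEquiv (S := Y.functionField) e.symm).1 this

lemma hasSeparableModel_functionField {k : Type} [Field k] [IsAlgClosed k] [CharZero k]
    {U : Y.Opens} [Nonempty U] (hU : IsAffineOpen U) (e : k[X] ≃+* Γ(Y, U)) (a : k)
    (hdeg : extensionDegree (functionFieldMap f) ≠ 0)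
    (h : ∀ x, f x = coordPoint hU e a → ¬IsRamifiedAt f x) :
    letI := (functionFieldMap f).toAlgebra
    HasSeparableModel ((Y.germToFunctionField U).hom.comp e.toRingHom) a X.functionField := by
  let := (functionFieldMap f).toAlgebra
  have : FiniteDimensional Y.functionField X.functionField :=
    Module.finite_of_finrank_pos (Nat.pos_of_ne_zero hdeg)
  have hV : IsAffineOpen (f ⁻¹ᵁ U) := hU.preimage f
  let := ((Y.germToFunctionField U).hom.comp e.toRingHom).toAlgebra
  let := ((f.app U).hom.comp e.toRingHom).toAlgebra
  let := ((X.germToFunctionField (f ⁻¹ᵁ U)).hom.comp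
    ((f.app U).hom.comp e.toRingHom)).toAlgebra
  have : IsFractionRing Γ(X, f ⁻¹ᵁ U) X.functionField :=
    functionField_isFractionRing_of_isAffineOpen X _ hV
  have : IsFractionRing k[X] Y.functionField := isFractionRing_coord hU e
  have : IsScalarTower k[X] Γ(X, f ⁻¹ᵁ U) X.functionField := .of_algebraMap_eq fun p => rfl
  have : IsScalarTower k[X] Y.functionField X.functionField := .of_algebraMap_eq fun p =>
    (functionFieldMap_germToFunctionField f U (e p)).symm
  have : Module.Finite k[X] Γ(X, f ⁻¹ᵁ U) := by
    have h1 : (f.app U).hom.Finite := f.finite_app U hU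
    exact h1.comp (RingHom.Finite.of_surjective _ e.surjective)
  exact hasSeparableModel_of_forall_prime (B := Γ(X, f ⁻¹ᵁ U)) a fun P hP hPa z hz =>
    exists_mul_mem_span_of_not_isRamifiedAt hU e a hV h P hP hPa hz

end Model

end CurveCover
namespace CurveCover

open Polynomial

/-! ### Moving the common branch point to infinity -/

section BranchPoints

variable {k : Type*} [Field k] [IsAlgClosed k] [CharZero k] {F K₁ K₂ : Type} [Field F] [Field K₁]
  [Field K₂] [Algebra F K₁] [Algebra F K₂] [Algebra k[X] F] [IsFractionRing k[X] F]
  [FiniteDimensional F K₁] [FiniteDimensional F K₂]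

lemma normalClosuresDisjoint_of_hasSeparableModel
    (h : ∀ a, HasSeparableModel (algebraMap k[X] F) a K₁ ∨
      HasSeparableModel (algebraMap k[X] F) a K₂) :
    NormalClosuresDisjoint F K₁ K₂ :=
  normalClosuresDisjoint_of_splitAlong (k := k) fun c j hj =>
    (h c).imp (fun h => h.splitAlong j (PowerSeries.C c + PowerSeries.X) (by simp) hj)
      fun h => h.splitAlong j (PowerSeries.C c + PowerSeries.X) (by simp) hj

omit [IsAlgClosed k] [CharZero k] [Algebra k[X] F] [IsFractionRing k[X] F] in
lemma ringHom_eq_algebraMap_aeval {ι : k[X] →+* F} {j : F →+* LaurentField k} {g : PowerSeries k}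
    (hC : ∀ c, j (ι (C c)) = algebraMap (PowerSeries k) (LaurentField k) (PowerSeries.C c))
    (hX : j (ι X) = algebraMap (PowerSeries k) (LaurentField k) g) (p : k[X]) :
    j (ι p) = algebraMap (PowerSeries k) (LaurentField k) (aeval g p) := by
  have h : j.comp ι = (algebraMap (PowerSeries k) (LaurentField k)).comp
      (aeval g : k[X] →ₐ[k] PowerSeries k).toRingHom :=
    Polynomial.ringHom_ext (fun c => by simpa using hC c) (by simpa using hX)
  exact RingHom.congr_fun h p

/-- If every point of the projective line except the point `X = α` of the affine line is not a
common branch point, then the normal closures are disjoint. -/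
lemma normalClosuresDisjoint_of_hasSeparableModel_of_ne (α : k) {ι : k[X] →+* F}
    (hC : ∀ c, ι (C c) = algebraMap k[X] F (C c)) (hX : algebraMap k[X] F X * ι X = 1)
    (h : ∀ a, a ≠ α → HasSeparableModel (algebraMap k[X] F) a K₁ ∨
      HasSeparableModel (algebraMap k[X] F) a K₂)
    (h0 : HasSeparableModel ι 0 K₁ ∨ HasSeparableModel ι 0 K₂) :
    NormalClosuresDisjoint F K₁ K₂ := by
  -- The coordinate `(X - α)⁻¹` sends `α` to infinity. Its value `0` is the old point at infinity,
  -- and a value `c ≠ 0` is the point `X = α + c⁻¹`.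
  have key : ∀ (c : k) (j : F →+* LaurentField k), (∀ p, j (invChart F α p) =
      algebraMap (PowerSeries k) (LaurentField k) (aeval (PowerSeries.C c + PowerSeries.X) p)) →
      SplitAlong j K₁ ∨ SplitAlong j K₂ := by
    intro c j hj
    have hjC : ∀ d, j (algebraMap k[X] F (C d)) =
        algebraMap (PowerSeries k) (LaurentField k) (PowerSeries.C d) := fun d => by
      rw [← invChart_C α, hj]
      simp
    have hjX : j (algebraMap k[X] F X - algebraMap k[X] F (C α)) *
        algebraMap (PowerSeries k) (LaurentField k) (PowerSeries.C c + PowerSeries.X) = 1 := by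
      have h1 := hj X
      rw [aeval_X, invChart_X] at h1
      rw [← h1, ← map_sub, ← map_mul, mul_inv_cancel₀ (algebraMap_X_sub_C_ne_zero α), map_one]
    rw [map_sub, hjC] at hjX
    by_cases hc : c = 0
    · subst hc
      rw [map_zero, zero_add] at hjX
      -- With `T` the local parameter, `X = α + 1/T`, so `1/X = T / (1 + α T)`.
      let v : PowerSeries k := 1 + PowerSeries.C α * PowerSeries.X
      have hv : v * v⁻¹ = 1 := PowerSeries.mul_inv_cancel _ (by simp [v])
      have hv' := congrArg (algebraMap (PowerSeries k) (LaurentField k)) hv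
      have hιX : j (ι X) =
          algebraMap (PowerSeries k) (LaurentField k) (PowerSeries.X * v⁻¹) := by
        have h2 := congrArg j hX
        rw [map_mul, map_one] at h2
        refine mul_left_cancel₀ (left_ne_zero_of_mul_eq_one h2) ?_
        rw [h2]
        simp only [v, map_mul, map_add, map_one] at hv' ⊢
        rw [← hv']
        linear_combination (-algebraMap (PowerSeries k) (LaurentField k) v⁻¹) * hjX
      refine h0.imp (fun h => h.splitAlong j _ ?_ (ringHom_eq_algebraMap_aeval ?_ hιX))
        fun h => h.splitAlong j _ ?_ (ringHom_eq_algebraMap_aeval ?_ hιX)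
      iterate 2
        · simp
        · intro d
          rw [hC, hjC]
    · let u : PowerSeries k := PowerSeries.C c + PowerSeries.X
      have hu : u * u⁻¹ = 1 := PowerSeries.mul_inv_cancel _ (by simp [u, hc])
      have hu' := congrArg (algebraMap (PowerSeries k) (LaurentField k)) hu
      rw [map_mul, map_one] at hu'
      have hgX : j (algebraMap k[X] F X) =
          algebraMap (PowerSeries k) (LaurentField k) (PowerSeries.C α + u⁻¹) := by
        rw [map_add, ← sub_eq_iff_eq_add']
        refine mul_right_cancel₀ (left_ne_zero_of_mul_eq_one hu') ?_
        rw [hjX, mul_comm, hu']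
      have hg : PowerSeries.constantCoeff (PowerSeries.C α + u⁻¹) = α + c⁻¹ := by simp [u]
      exact (h (α + c⁻¹) (by simpa using hc)).imp
        (fun h => h.splitAlong j _ hg (ringHom_eq_algebraMap_aeval hjC hgX))
        fun h => h.splitAlong j _ hg (ringHom_eq_algebraMap_aeval hjC hgX)
  have hfr := isFractionRing_invChart (F := F) α
  let := (invChart F α).toAlgebra
  exact normalClosuresDisjoint_of_splitAlong (k := k) key

end BranchPoints

section Covers

/-- On the overlap the two coordinates are mutually inverse, so neither vanishes there. -/
lemma coordPoint_zero_ne {i j : Fin (1 + 1)} (hij : i ≠ j) (α : ℂ) :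
    coordPoint (isAffineOpen_lineChart j) (lineChartEquiv hij.symm) 0 ≠
      coordPoint (isAffineOpen_lineChart i) (lineChartEquiv hij) α := by
  intro h
  set y := coordPoint (isAffineOpen_lineChart j) (lineChartEquiv hij.symm) 0 with hy
  have hyj : y ∈ lineChart j := coordPoint_mem _ _ _
  have hyi : y ∈ lineChart i := h ▸ coordPoint_mem _ _ _
  have h1 := isUnit_germ_coordPoint_iff _ _ hyj hy X
  rw [eval_X, ne_eq, eq_self_iff_true, not_true_eq_false, iff_false] at h1
  refine h1 (.of_mul_eq_one_right ((ProjSpace 1).presheaf.germ _ y hyi (lineChartEquiv hij X)) ?_)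
  apply IsFractionRing.injective ((ProjSpace 1).presheaf.stalk y) (ProjSpace 1).functionField
  have h2 := lineChartMap_X_mul hij
  rw [map_mul, map_one, ← h2]
  congr 1
  · exact (ProjSpace 1).algebraMap_germ_eq_germToFunctionField hyi _
  · exact (ProjSpace 1).algebraMap_germ_eq_germToFunctionField hyj _

variable {C₁ C₂ : Scheme.{0}} [IsIntegral C₁] [IsIntegral C₂] (π₁ : C₁ ⟶ ProjSpace 1)
  (π₂ : C₂ ⟶ ProjSpace 1) [IsDominant π₁] [IsDominant π₂] [IsFinite π₁] [IsFinite π₂]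

lemma normalClosuresDisjoint_functionField (hd₁ : extensionDegree (functionFieldMap π₁) ≠ 0)
    (hd₂ : extensionDegree (functionFieldMap π₂) ≠ 0)
    (hB : (branchLocus π₁ ∩ branchLocus π₂).encard ≤ 1) :
    letI := (functionFieldMap π₁).toAlgebra
    letI := (functionFieldMap π₂).toAlgebra
    NormalClosuresDisjoint (ProjSpace 1).functionField C₁.functionField C₂.functionField := by
  let := (functionFieldMap π₁).toAlgebra
  let := (functionFieldMap π₂).toAlgebra
  have : FiniteDimensional (ProjSpace 1).functionField C₁.functionField :=
    Module.finite_of_finrank_pos (Nat.pos_of_ne_zero hd₁)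
  have : FiniteDimensional (ProjSpace 1).functionField C₂.functionField :=
    Module.finite_of_finrank_pos (Nat.pos_of_ne_zero hd₂)
  have := jacobsonSpace_projSpace_one
  have key : ∀ {i j : Fin (1 + 1)} (hij : i ≠ j) (a : ℂ),
      coordPoint (isAffineOpen_lineChart i) (lineChartEquiv hij) a ∉
        branchLocus π₁ ∩ branchLocus π₂ →
      HasSeparableModel (lineChartMap hij) a C₁.functionField ∨
        HasSeparableModel (lineChartMap hij) a C₂.functionField := by
    intro i j hij a h
    have hc := isClosed_coordPoint (isAffineOpen_lineChart i) (lineChartEquiv hij) a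
    rcases not_and_or.1 h with h | h
    · exact .inl (hasSeparableModel_functionField π₁ (isAffineOpen_lineChart i)
        (lineChartEquiv hij) a hd₁ fun x hx hr => h ⟨hc, x, hx, hr⟩)
    · exact .inr (hasSeparableModel_functionField π₂ (isAffineOpen_lineChart i)
        (lineChartEquiv hij) a hd₂ fun x hx hr => h ⟨hc, x, hx, hr⟩)
  have h01 : (0 : Fin (1 + 1)) ≠ 1 := by decide
  have hfr : @IsFractionRing ℂ[X] _ (ProjSpace 1).functionField _ (lineChartMap h01).toAlgebra :=
    isFractionRing_coord (isAffineOpen_lineChart 0) (lineChartEquiv h01)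
  let := (lineChartMap h01).toAlgebra
  -- If a common branch point `α` lies in this chart, it is the only one, and infinity is harmless.
  -- Otherwise only infinity can be one, and the affine line suffices.
  by_cases hα : ∃ α, coordPoint (isAffineOpen_lineChart 0) (lineChartEquiv h01) α ∈
      branchLocus π₁ ∩ branchLocus π₂
  · obtain ⟨α, hα⟩ := hα
    rw [Set.encard_le_one_iff] at hB
    refine normalClosuresDisjoint_of_hasSeparableModel_of_ne α (ι := lineChartMap h01.symm)
      (lineChartMap_C h01) (lineChartMap_X_mul h01) (fun a ha => key h01 a fun h => ha ?_)
      (key h01.symm 0 fun h => ?_)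
    · exact coordPoint_injective _ _ (hB _ _ h hα)
    · exact coordPoint_zero_ne h01 α (hB _ _ h hα)
  · rw [not_exists] at hα
    exact normalClosuresDisjoint_of_hasSeparableModel (k := ℂ) fun a => key h01 a (hα a)

end Covers

end CurveCover
namespace CurveCover

/-! ### Integrality of tensor products and gluing -/

section TensorProduct

open Module TensorProduct

lemma injective_of_linearIndependent_comp_basis {R M N ι : Type*} [CommRing R] [AddCommGroup M]
    [AddCommGroup N] [Module R M] [Module R N] (b : Basis ι R M) (f : M →ₗ[R] N)
    (h : LinearIndependent R (f ∘ b)) : Function.Injective f := by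
  intro x y hxy
  rw [← b.linearCombination_repr x, ← b.linearCombination_repr y,
    Finsupp.apply_linearCombination, Finsupp.apply_linearCombination] at hxy
  exact b.repr.injective (h hxy)

/-- A tensor product of finite algebras over a principal ideal domain is a domain as soon as the
tensor product of their fraction fields is one. -/
lemma isDomain_tensorProduct_of_isFractionRing (A F B₁ B₂ K₁ K₂ : Type*) [CommRing A] [IsDomain A]
    [IsPrincipalIdealRing A] [Field F] [Algebra A F] [IsFractionRing A F] [CommRing B₁]
    [IsDomain B₁] [CommRing B₂] [IsDomain B₂] [Algebra A B₁] [Algebra A B₂] [Module.Finite A B₁]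
    [Module.Finite A B₂] [Field K₁] [Field K₂] [Algebra F K₁] [Algebra F K₂] [Algebra B₁ K₁]
    [Algebra B₂ K₂] [IsFractionRing B₁ K₁] [IsFractionRing B₂ K₂] [Algebra A K₁] [Algebra A K₂]
    [IsScalarTower A F K₁] [IsScalarTower A F K₂] [IsScalarTower A B₁ K₁] [IsScalarTower A B₂ K₂]
    [IsDomain (K₁ ⊗[F] K₂)] : IsDomain (B₁ ⊗[A] B₂) := by
  have hAF := IsFractionRing.injective A F
  have h₁ : Function.Injective (algebraMap A B₁) := by
    have h := (algebraMap F K₁).injective.comp hAF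
    rw [← RingHom.coe_comp, ← IsScalarTower.algebraMap_eq, IsScalarTower.algebraMap_eq A B₁ K₁] at h
    exact Function.Injective.of_comp (f := algebraMap B₁ K₁) h
  have h₂ : Function.Injective (algebraMap A B₂) := by
    have h := (algebraMap F K₂).injective.comp hAF
    rw [← RingHom.coe_comp, ← IsScalarTower.algebraMap_eq, IsScalarTower.algebraMap_eq A B₂ K₂] at h
    exact Function.Injective.of_comp (f := algebraMap B₂ K₂) h
  have : FaithfulSMul A B₁ := (faithfulSMul_iff_algebraMap_injective A B₁).2 h₁
  have : FaithfulSMul A B₂ := (faithfulSMul_iff_algebraMap_injective A B₂).2 h₂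
  have : Module.IsTorsionFree A B₁ := inferInstance
  have : Module.IsTorsionFree A B₂ := inferInstance
  have : Module.Free A B₁ := inferInstance
  have : Module.Free A B₂ := inferInstance
  let b₁ := Module.Free.chooseBasis A B₁
  let b₂ := Module.Free.chooseBasis A B₂
  let Φ : B₁ ⊗[A] B₂ →ₐ[A] K₁ ⊗[F] K₂ := Algebra.TensorProduct.productMap
    ((Algebra.TensorProduct.includeLeft (R := F) (S := A) (A := K₁) (B := K₂)).comp
      (IsScalarTower.toAlgHom A B₁ K₁))
    (((Algebra.TensorProduct.includeRight (R := F) (A := K₁) (B := K₂)).restrictScalars A).comp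
      (IsScalarTower.toAlgHom A B₂ K₂))
  have hi₁ : LinearIndependent F fun i => algebraMap B₁ K₁ (b₁ i) := by
    rw [← LinearIndependent.iff_fractionRing (R := A)]
    exact b₁.linearIndependent.map' (IsScalarTower.toAlgHom A B₁ K₁).toLinearMap
      (LinearMap.ker_eq_bot.2 (IsFractionRing.injective B₁ K₁))
  have hi₂ : LinearIndependent F fun i => algebraMap B₂ K₂ (b₂ i) := by
    rw [← LinearIndependent.iff_fractionRing (R := A)]
    exact b₂.linearIndependent.map' (IsScalarTower.toAlgHom A B₂ K₂).toLinearMap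
      (LinearMap.ker_eq_bot.2 (IsFractionRing.injective B₂ K₂))
  have hi := hi₁.tmul_of_flat_left hi₂
  rw [← LinearIndependent.iff_fractionRing (R := A)] at hi
  -- The products of basis elements stay independent over `F` in `K₁ ⊗ K₂`, hence over `A`.
  have hΦ : Function.Injective Φ := by
    refine injective_of_linearIndependent_comp_basis (b₁.tensorProduct b₂) Φ.toLinearMap ?_
    have h : (Φ.toLinearMap ∘ b₁.tensorProduct b₂ : _ → K₁ ⊗[F] K₂) =
        fun i => algebraMap B₁ K₁ (b₁ i.1) ⊗ₜ[F] algebraMap B₂ K₂ (b₂ i.2) := by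
      ext ⟨i, j⟩
      simp [Φ, Basis.tensorProduct_apply]
    rw [h]
    exact hi
  exact hΦ.isDomain Φ.toRingHom

end TensorProduct

section Gluing

lemma isIntegral_toScheme_of_isAffineOpen {X : Scheme.{0}} {U : X.Opens} (hU : IsAffineOpen U)
    [Nonempty U] [IsDomain Γ(X, U)] : IsIntegral U.toScheme := by
  have : IsAffine U.toScheme := hU
  have : IsDomain Γ(U.toScheme, ⊤) :=
    MulEquiv.isDomain Γ(X, U) U.topIso.commRingCatIsoToRingEquiv.toMulEquiv
  exact isIntegral_of_isAffine_of_isDomain _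

/-- A scheme is integral if it has a cover by integral open subschemes with a common point. -/
lemma isIntegral_of_iSup_eq_top {X : Scheme.{0}} {ι : Type} (U : ι → X.Opens) (hU : iSup U = ⊤)
    [∀ i, IsIntegral (U i).toScheme] (z : X) (hz : ∀ i, z ∈ U i) : IsIntegral X := by
  have hred : AlgebraicGeometry.IsReduced X := by
    have : ∀ x : X, _root_.IsReduced (X.presheaf.stalk x) := fun x => by
      obtain ⟨i, hi⟩ := TopologicalSpace.Opens.mem_iSup.1 (hU ▸ trivial : x ∈ iSup U)
      have h := (U i).stalkIso ⟨x, hi⟩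
      have hr : AlgebraicGeometry.IsReduced (U i).toScheme := isReduced_of_isIntegral _
      have : _root_.IsReduced ((U i).toScheme.presheaf.stalk ⟨x, hi⟩) :=
        isReduced_stalk_of_isReduced _ _
      exact isReduced_of_injective h.symm.commRingCatIsoToRingEquiv
        h.symm.commRingCatIsoToRingEquiv.injective
    exact isReduced_of_isReduced_stalk _
  have hirr : ∀ i, IsIrreducible (U i : Set X) := fun i => by
    have : IrreducibleSpace (U i : Set X) := inferInstanceAs (IrreducibleSpace (U i).toScheme)
    exact IsIrreducible.of_subtype
  have : IrreducibleSpace X :=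
    { toNonempty := ⟨z⟩
      isPreirreducible_univ := by
        rintro V W hV hW ⟨v, -, hv⟩ ⟨w, -, hw⟩
        obtain ⟨i, hi⟩ := TopologicalSpace.Opens.mem_iSup.1 (hU ▸ trivial : v ∈ iSup U)
        obtain ⟨j, hj⟩ := TopologicalSpace.Opens.mem_iSup.1 (hU ▸ trivial : w ∈ iSup U)
        -- The common point `z` makes `U i` and `U j` meet, so `V` can first be moved into `U j` and
        -- then compared there with `W`.
        obtain ⟨y, -, hy, hyj⟩ := (hirr i).2 V (U j) hV (U j).isOpen ⟨v, hi, hv⟩ ⟨z, hz i, hz j⟩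
        obtain ⟨x, -, hx⟩ := (hirr j).2 V W hV hW ⟨y, hyj, hy⟩ ⟨w, hj, hw⟩
        exact ⟨x, trivial, hx⟩ }
  exact isIntegral_of_irreducibleSpace_of_isReduced X

end Gluing

section FunctionFieldMap

variable {X Y Z : Scheme.{0}} [IsIntegral X] [IsIntegral Y] [IsIntegral Z]

lemma functionFieldMap_germToFunctionField_appLE (f : X ⟶ Y) [IsDominant f] (U : Y.Opens)
    [Nonempty U] (V : X.Opens) [Nonempty V] (h : V ≤ f ⁻¹ᵁ U) (s : Γ(Y, U)) :
    functionFieldMap f ((Y.germToFunctionField U).hom s) =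
      (X.germToFunctionField V).hom ((f.appLE U V h).hom s) := by
  rw [functionFieldMap_germToFunctionField, Scheme.Hom.appLE, CommRingCat.hom_comp,
    RingHom.comp_apply]
  exact (X.presheaf.germ_res_apply (homOfLE h) _ (genericPoint_mem V) _).symm

lemma functionFieldMap_comp (f : X ⟶ Y) (g : Y ⟶ Z) [IsDominant f] [IsDominant g]
    [IsDominant (f ≫ g)] : functionFieldMap (f ≫ g) = (functionFieldMap f).comp (functionFieldMap g) := by
  obtain ⟨U, hU, hz, -⟩ := exists_isAffineOpen_mem_and_subset (x := genericPoint Z) (U := ⊤) trivial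
  have : Nonempty U := ⟨⟨_, hz⟩⟩
  have := functionField_isFractionRing_of_isAffineOpen Z U hU
  refine IsLocalization.ringHom_ext (nonZeroDivisors Γ(Z, U)) (RingHom.ext fun s => ?_)
  have h1 := functionFieldMap_germToFunctionField (f ≫ g) U s
  have h2 := functionFieldMap_germToFunctionField g U s
  refine h1.trans (Eq.trans ?_ (congrArg (functionFieldMap f) h2).symm)
  rw [functionFieldMap_germToFunctionField f]
  rw [Scheme.Hom.comp_app]
  rfl

lemma functionFieldMap_congr {f g : X ⟶ Y} [IsDominant f] [IsDominant g] (h : f = g) :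
    functionFieldMap f = functionFieldMap g := by
  subst h
  rfl

end FunctionFieldMap

end CurveCover
namespace CurveCover

/-! ### Affine charts of the fiber product -/

section Pushout

open TensorProduct

lemma exists_ringEquiv_tensorProduct {A B₁ B₂ R : CommRingCat.{0}} {f₁ : A ⟶ B₁} {f₂ : A ⟶ B₂}
    {g₁ : B₁ ⟶ R} {g₂ : B₂ ⟶ R} (h : IsPushout f₁ f₂ g₁ g₂) :
    letI := f₁.hom.toAlgebra
    letI := f₂.hom.toAlgebra
    ∃ e : B₁ ⊗[A] B₂ ≃+* R, ∀ b c, e (b ⊗ₜ c) = g₁.hom b * g₂.hom c := by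
  let := f₁.hom.toAlgebra
  let := f₂.hom.toAlgebra
  let e := (CommRingCat.isPushout_tensorProduct A B₁ B₂).isoIsPushout _ _ h
  refine ⟨e.commRingCatIsoToRingEquiv, fun b c => ?_⟩
  have h1 : e.hom.hom (b ⊗ₜ 1) = g₁.hom b :=
    DFunLike.congr_fun (congrArg CommRingCat.Hom.hom
      ((CommRingCat.isPushout_tensorProduct A B₁ B₂).inl_isoIsPushout_hom _ _ h)) b
  have h2 : e.hom.hom (1 ⊗ₜ c) = g₂.hom c :=
    DFunLike.congr_fun (congrArg CommRingCat.Hom.hom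
      ((CommRingCat.isPushout_tensorProduct A B₁ B₂).inr_isoIsPushout_hom _ _ h)) c
  rw [← h1, ← h2]
  change e.hom.hom _ = _
  rw [← map_mul, Algebra.TensorProduct.tmul_mul_tmul, mul_one, one_mul]

end Pushout

section FiberProduct

variable {X₁ X₂ Y : Scheme.{0}} (π₁ : X₁ ⟶ Y) (π₂ : X₂ ⟶ Y)

/-- The part of the fiber product over an open subset of the base. -/
noncomputable def pullbackOver (U : Y.Opens) : (pullback π₁ π₂).Opens :=
  pullback.fst π₁ π₂ ⁻¹ᵁ (π₁ ⁻¹ᵁ U)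

lemma pullbackOver_eq (U : Y.Opens) : pullbackOver π₁ π₂ U =
    pullback.fst π₁ π₂ ⁻¹ᵁ (π₁ ⁻¹ᵁ U) ⊓ pullback.snd π₁ π₂ ⁻¹ᵁ (π₂ ⁻¹ᵁ U) := by
  have h : pullback.fst π₁ π₂ ⁻¹ᵁ (π₁ ⁻¹ᵁ U) = pullback.snd π₁ π₂ ⁻¹ᵁ (π₂ ⁻¹ᵁ U) := by
    rw [← Scheme.Hom.comp_preimage, ← Scheme.Hom.comp_preimage, pullback.condition]
  rw [← h, inf_idem, pullbackOver]

lemma pullbackOver_le_fst (U : Y.Opens) :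
    pullbackOver π₁ π₂ U ≤ pullback.fst π₁ π₂ ⁻¹ᵁ (π₁ ⁻¹ᵁ U) :=
  (pullbackOver_eq π₁ π₂ U).trans_le inf_le_left

lemma pullbackOver_le_snd (U : Y.Opens) :
    pullbackOver π₁ π₂ U ≤ pullback.snd π₁ π₂ ⁻¹ᵁ (π₂ ⁻¹ᵁ U) :=
  (pullbackOver_eq π₁ π₂ U).trans_le inf_le_right

variable [IsFinite π₁] [IsFinite π₂]

lemma isPushout_pullbackOver {U : Y.Opens} (hU : IsAffineOpen U) :
    IsPushout (π₁.app U) (π₂.app U)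
      ((pullback.fst π₁ π₂).appLE (π₁ ⁻¹ᵁ U) (pullbackOver π₁ π₂ U)
        (pullbackOver_le_fst π₁ π₂ U))
      ((pullback.snd π₁ π₂).appLE (π₂ ⁻¹ᵁ U) (pullbackOver π₁ π₂ U)
        (pullbackOver_le_snd π₁ π₂ U)) := by
  have h := (isIso_pushoutSection_iff (.of_hasPullback π₁ π₂) (le_refl (π₂ ⁻¹ᵁ U))
    (le_refl (π₁ ⁻¹ᵁ U)) (pullbackOver_eq π₁ π₂ U)).1
      (isIso_pushoutSection_of_isAffineOpen _ _ _ _ hU (hU.preimage π₂) (hU.preimage π₁))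
  rwa [Scheme.Hom.appLE_eq_app, Scheme.Hom.appLE_eq_app] at h

lemma isAffineOpen_pullbackOver {U : Y.Opens} (hU : IsAffineOpen U) :
    IsAffineOpen (pullbackOver π₁ π₂ U) :=
  (hU.preimage π₁).preimage (pullback.fst π₁ π₂)

end FiberProduct

/-! ### Integrality and function field of the fiber product -/

section IntegralFiberProduct

open TensorProduct

variable {X₁ X₂ Y : Scheme.{0}} [IsIntegral X₁] [IsIntegral X₂] [IsIntegral Y] (π₁ : X₁ ⟶ Y)
  (π₂ : X₂ ⟶ Y) [IsDominant π₁] [IsDominant π₂]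

/-- Such a point gives the dominance of both projections and lies in every chart used for gluing. -/
lemma exists_mem_pullback_genericPoint : ∃ z : ↥(pullback π₁ π₂),
    pullback.fst π₁ π₂ z = genericPoint X₁ ∧ pullback.snd π₁ π₂ z = genericPoint X₂ :=
  Scheme.Pullback.exists_preimage_pullback _ _ (by rw [map_genericPoint, map_genericPoint])

lemma isDominant_of_apply_eq_genericPoint {X Y : Scheme.{0}} [IrreducibleSpace Y] (f : X ⟶ Y)
    (x : X) (h : f x = genericPoint Y) : IsDominant f where
  denseRange := by
    rw [DenseRange, dense_iff_closure_eq, Set.eq_univ_iff_forall]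
    intro y
    have h1 : y ∈ closure {genericPoint Y} := by
      rw [(genericPoint_spec Y)]
      trivial
    exact closure_mono (Set.singleton_subset_iff.2 (Set.mem_range.2 ⟨x, h⟩)) h1

instance isDominant_pullback_fst : IsDominant (pullback.fst π₁ π₂) := by
  obtain ⟨z, hz, -⟩ := exists_mem_pullback_genericPoint π₁ π₂
  exact isDominant_of_apply_eq_genericPoint _ z hz

instance isDominant_pullback_snd : IsDominant (pullback.snd π₁ π₂) := by
  obtain ⟨z, -, hz⟩ := exists_mem_pullback_genericPoint π₁ π₂
  exact isDominant_of_apply_eq_genericPoint _ z hz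

variable [IsFinite π₁] [IsFinite π₂]

lemma isDomain_pullbackOver {U : Y.Opens} [Nonempty U] (hU : IsAffineOpen U)
    [IsPrincipalIdealRing Γ(Y, U)]
    (h : letI := (functionFieldMap π₁).toAlgebra
      letI := (functionFieldMap π₂).toAlgebra
      IsDomain (X₁.functionField ⊗[Y.functionField] X₂.functionField)) :
    IsDomain Γ(pullback π₁ π₂, pullbackOver π₁ π₂ U) := by
  obtain ⟨e, -⟩ := exists_ringEquiv_tensorProduct (isPushout_pullbackOver π₁ π₂ hU)
  let := (π₁.app U).hom.toAlgebra
  let := (π₂.app U).hom.toAlgebra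
  let := (functionFieldMap π₁).toAlgebra
  let := (functionFieldMap π₂).toAlgebra
  let := ((functionFieldMap π₁).comp (Y.germToFunctionField U).hom).toAlgebra
  let := ((functionFieldMap π₂).comp (Y.germToFunctionField U).hom).toAlgebra
  have := functionField_isFractionRing_of_isAffineOpen Y U hU
  have := functionField_isFractionRing_of_isAffineOpen X₁ _ (hU.preimage π₁)
  have := functionField_isFractionRing_of_isAffineOpen X₂ _ (hU.preimage π₂)
  have : Module.Finite Γ(Y, U) Γ(X₁, π₁ ⁻¹ᵁ U) := π₁.finite_app U hU
  have : Module.Finite Γ(Y, U) Γ(X₂, π₂ ⁻¹ᵁ U) := π₂.finite_app U hU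
  have : IsScalarTower Γ(Y, U) Y.functionField X₁.functionField := .of_algebraMap_eq fun _ => rfl
  have : IsScalarTower Γ(Y, U) Y.functionField X₂.functionField := .of_algebraMap_eq fun _ => rfl
  have : IsScalarTower Γ(Y, U) Γ(X₁, π₁ ⁻¹ᵁ U) X₁.functionField :=
    .of_algebraMap_eq (functionFieldMap_germToFunctionField π₁ U)
  have : IsScalarTower Γ(Y, U) Γ(X₂, π₂ ⁻¹ᵁ U) X₂.functionField :=
    .of_algebraMap_eq (functionFieldMap_germToFunctionField π₂ U)
  have : IsDomain (Γ(X₁, π₁ ⁻¹ᵁ U) ⊗[Γ(Y, U)] Γ(X₂, π₂ ⁻¹ᵁ U)) :=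
    isDomain_tensorProduct_of_isFractionRing Γ(Y, U) Y.functionField _ _ X₁.functionField
      X₂.functionField
  exact e.symm.toMulEquiv.isDomain _

theorem isIntegral_pullback {ι : Type} (U : ι → Y.Opens) (hU : iSup U = ⊤) [∀ i, Nonempty (U i)]
    (hUa : ∀ i, IsAffineOpen (U i)) [∀ i, IsPrincipalIdealRing Γ(Y, U i)]
    (h : letI := (functionFieldMap π₁).toAlgebra
      letI := (functionFieldMap π₂).toAlgebra
      IsDomain (X₁.functionField ⊗[Y.functionField] X₂.functionField)) :
    IsIntegral (pullback π₁ π₂) := by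
  obtain ⟨z, hz, -⟩ := exists_mem_pullback_genericPoint π₁ π₂
  have hzU : ∀ i, z ∈ pullbackOver π₁ π₂ (U i) := fun i => by
    change π₁ (pullback.fst π₁ π₂ z) ∈ U i
    rw [hz, map_genericPoint]
    exact genericPoint_mem _
  have : ∀ i, IsIntegral (pullbackOver π₁ π₂ (U i)).toScheme := fun i => by
    have : Nonempty (pullbackOver π₁ π₂ (U i)) := ⟨⟨z, hzU i⟩⟩
    have := isDomain_pullbackOver π₁ π₂ (hUa i) h
    exact isIntegral_toScheme_of_isAffineOpen (isAffineOpen_pullbackOver π₁ π₂ (hUa i))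
  refine isIntegral_of_iSup_eq_top (fun i => pullbackOver π₁ π₂ (U i)) ?_ z hzU
  rw [eq_top_iff]
  intro x _
  obtain ⟨i, hi⟩ := TopologicalSpace.Opens.mem_iSup.1
    (hU ▸ trivial : π₁ (pullback.fst π₁ π₂ x) ∈ iSup U)
  exact TopologicalSpace.Opens.mem_iSup.2 ⟨i, hi⟩

/-- The function field of an integral fiber product is generated by the function fields of the
factors. -/
lemma mem_of_range_functionFieldMap_le [IsIntegral (pullback π₁ π₂)]
    (L : Subfield (pullback π₁ π₂).functionField)
    (h₁ : (functionFieldMap (pullback.fst π₁ π₂)).fieldRange ≤ L)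
    (h₂ : (functionFieldMap (pullback.snd π₁ π₂)).fieldRange ≤ L)
    (x : (pullback π₁ π₂).functionField) : x ∈ L := by
  obtain ⟨U, hU, hy, -⟩ := exists_isAffineOpen_mem_and_subset (x := genericPoint Y) (U := ⊤) trivial
  have : Nonempty U := ⟨⟨_, hy⟩⟩
  have : Nonempty (pullbackOver π₁ π₂ U) :=
    nonempty_preimage (pullback.fst π₁ π₂) (π₁ ⁻¹ᵁ U)
  have := functionField_isFractionRing_of_isAffineOpen _ _ (isAffineOpen_pullbackOver π₁ π₂ hU)
  obtain ⟨e, he⟩ := exists_ringEquiv_tensorProduct (isPushout_pullbackOver π₁ π₂ hU)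
  have key : ∀ s : Γ(pullback π₁ π₂, pullbackOver π₁ π₂ U),
      ((pullback π₁ π₂).germToFunctionField (pullbackOver π₁ π₂ U)).hom s ∈ L := by
    intro s
    let := (π₁.app U).hom.toAlgebra
    let := (π₂.app U).hom.toAlgebra
    obtain ⟨t, rfl⟩ := e.surjective s
    induction t with
    | zero => rw [map_zero, map_zero]; exact zero_mem L
    | add a b ha hb => rw [map_add, map_add]; exact add_mem ha hb
    | tmul b c =>
      rw [he, map_mul, ← functionFieldMap_germToFunctionField_appLE,
        ← functionFieldMap_germToFunctionField_appLE]
      exact mul_mem (h₁ ⟨_, rfl⟩) (h₂ ⟨_, rfl⟩)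
  obtain ⟨a, b, -, rfl⟩ := IsFractionRing.div_surjective
    (A := Γ(pullback π₁ π₂, pullbackOver π₁ π₂ U)) x
  exact div_mem (key a) (key b)

end IntegralFiberProduct

end CurveCover
namespace CurveCover

/-! ### The Galois closure of the fiber product -/

section FiberProductGalois

lemma isPrincipalIdealRing_lineChart (i : Fin (1 + 1)) :
    IsPrincipalIdealRing Γ(ProjSpace 1, lineChart i) := by
  obtain ⟨j, hij⟩ := exists_ne i
  exact IsPrincipalIdealRing.of_surjective (lineChartEquiv hij.symm).toRingHom
    (lineChartEquiv hij.symm).surjective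

lemma charZero_functionField_projSpace_one : CharZero (ProjSpace 1).functionField :=
  charZero_of_injective_ringHom
    ((lineChartMap (i := 0) (j := 1) (by decide)).comp Polynomial.C).injective

/-- `degree` is `0` for a morphism that is not dominant, and `finrank` is `0` in infinite degree; a
nonzero degree thus encodes both dominance and finiteness of the field extension. -/
lemma exists_isDominant_of_degree_ne_zero {X Y : Scheme.{0}} [IsIntegral X] [IsIntegral Y]
    {f : X ⟶ Y} (h : degree f ≠ 0) :
    ∃ _ : IsDominant f, extensionDegree (functionFieldMap f) ≠ 0 := by
  by_cases hf : IsDominant f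
  · refine ⟨hf, ?_⟩
    rwa [degree, dif_pos hf] at h
  · rw [degree, dif_neg hf] at h
    exact absurd rfl h

/-- The Galois group of the Galois closure of a fiber product whose factors have disjoint Galois
closures. -/
lemma nonempty_galoisClosureGroup_mulEquiv {X₁ X₂ Y : Scheme.{0}} [IsIntegral X₁] [IsIntegral X₂]
    [IsIntegral Y] (π₁ : X₁ ⟶ Y) (π₂ : X₂ ⟶ Y) [IsDominant π₁] [IsDominant π₂] [IsFinite π₁]
    [IsFinite π₂] [IsIntegral (pullback π₁ π₂)] [IsDominant (pullback.fst π₁ π₂ ≫ π₁)]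
    [CharZero Y.functionField] (hd₁ : extensionDegree (functionFieldMap π₁) ≠ 0)
    (hd₂ : extensionDegree (functionFieldMap π₂) ≠ 0)
    (hd : letI := (functionFieldMap π₁).toAlgebra
      letI := (functionFieldMap π₂).toAlgebra
      NormalClosuresDisjoint Y.functionField X₁.functionField X₂.functionField) :
    Nonempty (GaloisClosureGroup (pullback.fst π₁ π₂ ≫ π₁) ≃*
      GaloisClosureGroup π₁ × GaloisClosureGroup π₂) := by
  let := (functionFieldMap π₁).toAlgebra
  let := (functionFieldMap π₂).toAlgebra
  let := (functionFieldMap (pullback.fst π₁ π₂ ≫ π₁)).toAlgebra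
  have : FiniteDimensional Y.functionField X₁.functionField :=
    Module.finite_of_finrank_pos (Nat.pos_of_ne_zero hd₁)
  have : FiniteDimensional Y.functionField X₂.functionField :=
    Module.finite_of_finrank_pos (Nat.pos_of_ne_zero hd₂)
  have : IsDominant (pullback.snd π₁ π₂ ≫ π₂) := pullback.condition (f := π₁) (g := π₂) ▸ ‹_›
  let i₁ : X₁.functionField →ₐ[Y.functionField] (pullback π₁ π₂).functionField :=
    { functionFieldMap (pullback.fst π₁ π₂) with
      commutes' := fun r => (RingHom.congr_fun
        (functionFieldMap_comp (pullback.fst π₁ π₂) π₁) r).symm }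
  let i₂ : X₂.functionField →ₐ[Y.functionField] (pullback π₁ π₂).functionField :=
    { functionFieldMap (pullback.snd π₁ π₂) with
      commutes' := fun r => (RingHom.congr_fun
        ((functionFieldMap_congr pullback.condition).trans
          (functionFieldMap_comp (pullback.snd π₁ π₂) π₂)) r).symm }
  refine hd.nonempty_mulEquiv i₁ i₂ (eq_top_iff.2 fun x _ => ?_)
  refine mem_of_range_functionFieldMap_le π₁ π₂ (i₁.fieldRange ⊔ i₂.fieldRange).toSubfield ?_ ?_ x
  · exact fun y hy => (le_sup_left : i₁.fieldRange ≤ i₁.fieldRange ⊔ i₂.fieldRange) hy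
  · exact fun y hy => (le_sup_right : i₂.fieldRange ≤ i₁.fieldRange ⊔ i₂.fieldRange) hy

end FiberProductGalois

end CurveCover

theorem mainTheorem10 {C₁ C₂ : Scheme.{0}} [IsIntegral C₁] [IsIntegral C₂]
    (s₁ : C₁ ⟶ Spec (CommRingCat.of ℂ)) (s₂ : C₂ ⟶ Spec (CommRingCat.of ℂ))
    [SmoothOfRelativeDimension 1 s₁] [SmoothOfRelativeDimension 1 s₂]
    (hs₁ : CurveCover.IsProjective s₁) (hs₂ : CurveCover.IsProjective s₂)
    (π₁ : C₁ ⟶ CurveCover.ProjSpace 1) (π₂ : C₂ ⟶ CurveCover.ProjSpace 1)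
    (hπ₁ : π₁ ≫ CurveCover.ProjSpace.toSpec 1 = s₁)
    (hπ₂ : π₂ ≫ CurveCover.ProjSpace.toSpec 1 = s₂)
    [IsFinite π₁] [IsFinite π₂]
    (hd₁ : 2 ≤ CurveCover.degree π₁) (hd₂ : 2 ≤ CurveCover.degree π₂)
    (hB : (CurveCover.branchLocus π₁ ∩ CurveCover.branchLocus π₂).encard ≤ 1) :
    IrreducibleSpace ↥(pullback π₁ π₂) ∧
    ∃ (_ : IsIntegral (pullback π₁ π₂)) (_ : IsDominant π₁) (_ : IsDominant π₂)
      (_ : IsDominant (pullback.fst π₁ π₂ ≫ π₁)),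
      Nonempty (CurveCover.GaloisClosureGroup (pullback.fst π₁ π₂ ≫ π₁) ≃*
        CurveCover.GaloisClosureGroup π₁ × CurveCover.GaloisClosureGroup π₂) := by

  obtain ⟨hD₁, he₁⟩ := CurveCover.exists_isDominant_of_degree_ne_zero
    (f := π₁) (by omega)
  obtain ⟨hD₂, he₂⟩ := CurveCover.exists_isDominant_of_degree_ne_zero
    (f := π₂) (by omega)
  have := CurveCover.isPrincipalIdealRing_lineChart
  have := CurveCover.charZero_functionField_projSpace_one
  have hdis := CurveCover.normalClosuresDisjoint_functionField π₁ π₂ he₁ he₂ hB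
  have hint : IsIntegral (pullback π₁ π₂) := by
    refine CurveCover.isIntegral_pullback π₁ π₂ CurveCover.lineChart CurveCover.iSup_lineChart
      CurveCover.isAffineOpen_lineChart ?_
    let := (CurveCover.functionFieldMap π₁).toAlgebra
    let := (CurveCover.functionFieldMap π₂).toAlgebra
    have : FiniteDimensional (CurveCover.ProjSpace 1).functionField C₁.functionField :=
      Module.finite_of_finrank_pos (Nat.pos_of_ne_zero he₁)
    have : FiniteDimensional (CurveCover.ProjSpace 1).functionField C₂.functionField :=
      Module.finite_of_finrank_pos (Nat.pos_of_ne_zero he₂)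
    exact hdis.isDomain_tensorProduct
  have hdom : IsDominant (pullback.fst π₁ π₂ ≫ π₁) := inferInstance
  exact ⟨inferInstance, hint, hD₁, hD₂, hdom,
    CurveCover.nonempty_galoisClosureGroup_mulEquiv π₁ π₂ he₁ he₂ hdis⟩
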